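/- Let $K$ be a number field of degree $n=[K:\mathbb{Q}]$ with ring of integers $\mathcal{O}_K$, and let $p$ be a rational prime that is inert in $K$, i.e. $p\mathcal{O}_K$ is a prime ideal. Let $R_p=\mathcal{O}_K\otimes_{\mathbb{Z}}\mathbb{Z}_p$ and let $L_p=L(R_p)$ be the Heisenberg Lie ring over $R_p$, i.e. the $\mathbb{Z}_p$-Lie algebra of strictly upper triangular $3\times 3$ matrices over $R_p$ with the commutator bracket. For a $\mathbb{Z}_p$-Lie algebra $L$ with finitely many ideals of each finite index, let $$\zeta^{\triangleleft}_{L}(s)=\sum_{m\ge 1} a_m^{\triangleleft}(L)\,m^{-s},$$ where $a_m^{\triangleleft}(L)$ is the number of $\mathbb{Z}_p$-ideals of $L$ of additive index $m$; $\mathbb{Z}_p^{2n}$ is regarded as an abelian Lie ring. For $h\ge 1$ let $$I_h(Y;X_1,\dots,X_h)=\frac{1}{1-X_h}\sum_{I\subseteq\{1,\dots,h-1\}}\binom{h}{I}_Y\prod_{i\in I}\frac{X_i}{1-X_i},$$ where for $I=\{i_1<\dots<i_m\}$ $$\binom{h}{I}_Y=\binom{h}{i_m}_Y\binom{i_m}{i_{m-1}}_Y\cdots\binom{i_2}{i_1}_Y,\qquad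 \binom{a}{b}_Y=\frac{\prod_{i=a-b+1}^{a}(1-Y^i)}{\prod_{i=1}^{b}(1-Y^i)}.$$ Then $L_p$ and $\mathbb{Z}_p^{2n}$ have only finitely many ideals of each finite index, and for every $s\in\mathbb{C}$ with $\operatorname{Re}(s)>2n-1$ both series $\zeta^{\triangleleft}_{L_p}(s)$ and $\zeta^{\triangleleft}_{\mathbb{Z}_p^{2n}}(s)$ converge absolutely and $$\zeta^{\triangleleft}_{L_p}(s)=\zeta^{\triangleleft}_{\mathbb{Z}_p^{2n}}(s)\cdot I_n(p^{-1};x_1,\dots,x_n),\qquad x_j=p^{j(3n-j)}t^{2n+j}\ (1\le j\le n),\quad t=p^{-s}.$$ -/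

import Mathlib

open scoped NumberField TensorProduct

attribute [local instance 100] LieRing.ofAssociativeRing

noncomputable section

/-- The Heisenberg Lie ring `L(R)` of strictly upper triangular `3 × 3` matrices over `R`, with the
commutator bracket of `gl₃(R)`, as a Lie algebra over a base ring `S`. -/
def heisenbergLie (S R : Type*) [CommRing S] [CommRing R] [Algebra S R] :
    LieSubalgebra S (Matrix (Fin 3) (Fin 3) R) where
  carrier := {A | ∀ i j, j ≤ i → A i j = 0}
  zero_mem' := by intro i j _; simp
  add_mem' := by
    intro A B hA hB i j h
    simp [hA i j h, hB i j h]
  smul_mem' := by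
    intro c A hA i j h
    simp [hA i j h]
  lie_mem' := by
    intro A B hA hB i j h
    have key : ∀ M N : Matrix (Fin 3) (Fin 3) R, (∀ i j, j ≤ i → M i j = 0) →
        (∀ i j, j ≤ i → N i j = 0) → (M * N) i j = 0 := by
      intro M N hM hN
      rw [Matrix.mul_apply]
      refine Finset.sum_eq_zero fun k _ => ?_
      rcases le_total k i with hk | hk
      · rw [hM i k hk, zero_mul]
      · rw [hN k j (h.trans hk), mul_zero]
    rw [Ring.lie_def, Matrix.sub_apply, key A B hA hB, key B A hB hA, sub_zero]

section IdealZeta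

variable (S L : Type*) [CommRing S] [LieRing L] [LieAlgebra S L]

/-- The set of `S`-ideals of `L` of additive index `m` (for `m ≥ 1`; Mathlib's index is `0` exactly
when the true index is infinite). -/
def idealsOfIndex (m : ℕ) : Set (LieIdeal S L) :=
  {I | I.toSubmodule.toAddSubgroup.index = m}

/-- The number `a_m` of `S`-ideals of `L` of additive index `m`, as a Dirichlet coefficient. -/
def idealCoeff (m : ℕ) : ℂ := ((idealsOfIndex S L m).ncard : ℂ)

/-- The ideal zeta function of `L`: the Dirichlet series `∑_{m ≥ 1} a_m m^{-s}`. -/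
def idealZeta (s : ℂ) : ℂ := LSeries (idealCoeff S L) s

end IdealZeta

section Igusa

variable {F : Type*} [Field F]

/-- The Gaussian binomial coefficient `(a choose b)_Y` for `b ≤ a`, at a `Y` that is not a root
of unity. -/
def gaussBinom (Y : F) (a b : ℕ) : F :=
  (∏ i ∈ Finset.Icc (a - b + 1) a, (1 - Y ^ i)) / ∏ i ∈ Finset.Icc 1 b, (1 - Y ^ i)

/-- For a descending list `i_m > ... > i_1`, the product
`(h choose i_m)_Y (i_m choose i_{m-1})_Y ⋯ (i_2 choose i_1)_Y`. -/
def gaussMultinomialList (Y : F) : ℕ → List ℕ → F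
  | _, [] => 1
  | h, i :: l => gaussBinom Y h i * gaussMultinomialList Y i l

/-- The Gaussian multinomial `(h choose I)_Y` of a subset `I ⊆ {1, ..., h - 1}`. -/
def gaussMultinomial (Y : F) (h : ℕ) (I : Finset ℕ) : F :=
  gaussMultinomialList Y h (I.sort (fun a b => b ≤ a))

/-- The Igusa function `I_h(Y; X_1, ..., X_h)`, for `h ≥ 1`. -/
def igusa (h : ℕ) (Y : F) (X : ℕ → F) : F :=
  1 / (1 - X h) * ∑ I ∈ (Finset.Icc 1 (h - 1)).powerset,
    gaussMultinomial Y h I * ∏ i ∈ I, X i / (1 - X i)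

end Igusa

end

/-! Write `L = (R × R) × R` with centre `R`. A finite-index submodule `I` amounts to its
intersection `M` with the centre, its projection `N₀` to `R × R`, and a linear map `N₀ → R / M`. It
is an ideal when all products of coordinates of `N₀` with elements of `R` lie in `M`. Since `p` is
inert, every element of `R` outside `pR` is a unit, so `aR ⊆ M` means `a ∈ p ^ e R`, where `p ^ e`
is the exponent of `R / M` (`forall_mul_mem_iff`, `lie_mem_iff`). Hence `N₀ = p ^ e • N` with `N` an
arbitrary finite-index submodule (`heisenbergIdeal_bijective`). The index of `I` is `[R × R : N] * p
^ (2ne) * [R : M]`, and there are `[R : M] ^ (2n)` gluing maps, so the sum over `I` splits. The sum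
over `N` is the zeta function of `ℤ_p ^ (2n)`; the other factor is the sum over `M` of `[R : M] ^
(2n - s) * t ^ (2ne)`.

To evaluate such sums, filter a lattice `M ≤ V` by `W_k = M + p ^ k V`. Given the preceding step,
`W_{k+1}` is a lattice between `p W_k` and `W_k` with `W_{k+1} + p W_{k-1} = W_k`. Counting these is
a problem about subspaces over `𝔽_p` and gives a power of `p` times a Gaussian binomial. So lattices
with quotient of exponent `p ^ e` contribute a sum over chains of length `e`
(`finsum_latticeLayer`). Summing over `e` gives the Igusa function, which satisfies the same
recursion (`igusa_recursion`, `hasSum_igusaTerm`). For `Re s > 2n - 1` all variables have norm less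
than 1, which gives absolute convergence. -/

/-! ### Subspaces over a finite field transversal to a given one. -/

section SubspaceCount

open Module

variable {k X : Type*} [Field k] [Finite k] [AddCommGroup X] [Module k X] [Finite X]

/-- The number of tuples of length `j` in `X` that are linearly independent modulo a subspace. -/
theorem card_linearIndependent_mkQ (A : Submodule k X) {i j : ℕ} (hj : j ≤ i)
    (hA : finrank k A + i = finrank k X) :
    Nat.card {s : Fin j → X // LinearIndependent k (A.mkQ ∘ s)} =
      (∏ l : Fin j, (Nat.card k ^ i - Nat.card k ^ (l : ℕ))) * (Nat.card k ^ finrank k A) ^ j := by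
  classical
  have := Fintype.ofFinite k
  obtain ⟨B, hB⟩ := A.exists_isCompl
  have hBi : finrank k B = i := by
    have := Submodule.finrank_add_eq_of_isCompl hB
    omega
  let e := Submodule.prodEquivOfIsCompl B A hB.symm
  -- Relative to a complement `B` of `A`, independence modulo `A` depends only on the
  -- `B`-components; the `A`-components are free.
  have hLI : ∀ f : Fin j → B × A, LinearIndependent k (A.mkQ ∘ fun l => e (f l)) ↔
      LinearIndependent k (fun l => (f l).1) := by
    intro f
    have h1 : (A.mkQ ∘ fun l => e (f l)) = (A.mkQ ∘ₗ B.subtype) ∘ fun l => (f l).1 := by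
      funext l
      simp [e]
    rw [h1]
    refine LinearMap.linearIndependent_iff _ ?_
    rw [LinearMap.ker_comp, Submodule.ker_mkQ, ← Submodule.disjoint_iff_comap_eq_bot]
    exact hB.symm.disjoint
  let E : {s : Fin j → X // LinearIndependent k (A.mkQ ∘ s)} ≃
      {s : Fin j → B // LinearIndependent k s} × (Fin j → A) :=
    { toFun := fun s => ⟨⟨fun l => (e.symm (s.1 l)).1, by
          rw [← hLI fun l => e.symm (s.1 l)]
          simpa using s.2⟩, fun l => (e.symm (s.1 l)).2⟩
      invFun := fun t => ⟨fun l => e (t.1.1 l, t.2 l), by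
          rw [hLI fun l => (t.1.1 l, t.2 l)]
          exact t.1.2⟩
      left_inv := fun s => by ext; simp
      right_inv := fun t => by ext <;> simp }
  rw [Nat.card_congr E, Nat.card_prod, card_linearIndependent (by omega), hBi, Nat.card_fun,
    Module.natCard_eq_pow_finrank (K := k) (V := A)]
  simp

/-- Tuples that are linearly independent modulo `A` are bases of subspaces disjoint from `A`. -/
def linearIndependentMkQEquiv (A : Submodule k X) (j : ℕ) :
    {s : Fin j → X // LinearIndependent k (A.mkQ ∘ s)} ≃
      Σ D : {D : Submodule k X // finrank k D = j ∧ Disjoint D A},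
        {t : Fin j → D.1 // LinearIndependent k t} where
  toFun s := ⟨⟨Submodule.span k (Set.range s.1), by
      rw [finrank_span_eq_card (LinearIndependent.of_comp _ s.2), Fintype.card_fin], by
      simpa using Submodule.range_ker_disjoint s.2⟩,
    ⟨fun l => ⟨s.1 l, Submodule.subset_span ⟨l, rfl⟩⟩, by
      have := LinearIndependent.of_comp _ s.2
      exact LinearIndependent.of_comp (Submodule.subtype _) this⟩⟩
  invFun t := ⟨fun l => (t.2.1 l : X), by
    have : (A.mkQ ∘ fun l => (t.2.1 l : X)) = (A.mkQ ∘ₗ t.1.1.subtype) ∘ t.2.1 := rfl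
    rw [this]
    refine t.2.2.map' _ ?_
    rw [LinearMap.ker_comp, Submodule.ker_mkQ, ← Submodule.disjoint_iff_comap_eq_bot]
    exact t.1.2.2⟩
  left_inv s := rfl
  right_inv := by
    rintro ⟨⟨D, hD, hDA⟩, t, ht⟩
    obtain ⟨s, hs⟩ : ∃ s : Fin j → X, ∀ l, s l = (t l : X) := ⟨_, fun _ => rfl⟩
    have hsD : ∀ l, s l ∈ D := fun l => hs l ▸ (t l).2
    obtain rfl : t = fun l => ⟨s l, hsD l⟩ := funext fun l => Subtype.ext (hs l).symm
    have hspan : Submodule.span k (Set.range s) = D := by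
      have h2 : LinearIndependent k s := ht.map' D.subtype D.ker_subtype
      refine Submodule.eq_of_le_of_finrank_eq ?_ ?_
      · rw [Submodule.span_le]
        rintro _ ⟨l, rfl⟩
        exact hsD l
      · rw [finrank_span_eq_card h2, hD, Fintype.card_fin]
    subst hspan
    rfl

/-- Double counting of the tuples independent modulo `A`: each is an ordered basis of exactly one
such `D`, and every `D` has the same number of ordered bases. The product form avoids division in
`ℕ`. -/
theorem card_disjoint_subspaces (A : Submodule k X) {i j : ℕ} (hj : j ≤ i)
    (hA : finrank k A + i = finrank k X) :
    Nat.card {D : Submodule k X // finrank k D = j ∧ Disjoint D A} *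
        ∏ l : Fin j, (Nat.card k ^ j - Nat.card k ^ (l : ℕ)) =
      (∏ l : Fin j, (Nat.card k ^ i - Nat.card k ^ (l : ℕ))) *
        (Nat.card k ^ finrank k A) ^ j := by
  classical
  have := Fintype.ofFinite k
  have := Fintype.ofFinite {D : Submodule k X // finrank k D = j ∧ Disjoint D A}
  rw [← card_linearIndependent_mkQ A hj hA, Nat.card_congr (linearIndependentMkQEquiv A j),
    Nat.card_sigma]
  have h : ∀ D : {D : Submodule k X // finrank k D = j ∧ Disjoint D A},
      Nat.card {t : Fin j → D.1 // LinearIndependent k t} =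
        ∏ l : Fin j, (Nat.card k ^ j - Nat.card k ^ (l : ℕ)) := by
    intro D
    rw [card_linearIndependent D.2.1.ge, D.2.1]
    simp
  rw [Finset.sum_congr rfl fun D _ => h D]
  simp [Nat.card_eq_fintype_card]

/-- Subspaces of codimension `j` that span `X` together with `U` correspond to subspaces of the
dual space of dimension `j` that are disjoint from the annihilator of `U`. -/
def codisjointEquivDisjointDual (U : Submodule k X) (j : ℕ) :
    {W : Submodule k X // finrank k (X ⧸ W) = j ∧ W ⊔ U = ⊤} ≃
      {D : Submodule k (Dual k X) // finrank k D = j ∧ Disjoint D U.dualAnnihilator} :=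
  (Subspace.orderIsoFiniteDimensional (K := k) (V := X)).toEquiv.trans
    OrderDual.ofDual |>.subtypeEquiv fun W => by
      have h1 : finrank k (X ⧸ W) = finrank k W.dualAnnihilator :=
        (Subspace.quotEquivAnnihilator W).finrank_eq
      have h2 : W ⊔ U = ⊤ ↔ Disjoint W.dualAnnihilator U.dualAnnihilator := by
        rw [disjoint_iff, ← Submodule.dualAnnihilator_sup_eq, Submodule.dualAnnihilator_eq_bot_iff]
      rw [h1, h2]
      rfl

theorem card_codisjoint_subspaces (U : Submodule k X) {j : ℕ} (hj : j ≤ finrank k U) :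
    Nat.card {W : Submodule k X // finrank k (X ⧸ W) = j ∧ W ⊔ U = ⊤} *
        ∏ l : Fin j, (Nat.card k ^ j - Nat.card k ^ (l : ℕ)) =
      (∏ l : Fin j, (Nat.card k ^ finrank k U - Nat.card k ^ (l : ℕ))) *
        (Nat.card k ^ (finrank k X - finrank k U)) ^ j := by
  have : Finite (Dual k X) := Module.finite_of_finite k
  have h := Subspace.finrank_add_finrank_dualAnnihilator_eq U
  rw [Nat.card_congr (codisjointEquivDisjointDual U j),
    card_disjoint_subspaces U.dualAnnihilator hj (by rw [Subspace.dual_finrank_eq]; omega)]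
  congr 3
  omega

end SubspaceCount

/-! ### Gaussian binomials at `q⁻¹`. -/

section GaussBinom

variable {F : Type*} [Field F]

theorem prod_pow_sub_pow_eq {q : F} (hq : q ≠ 0) {i j : ℕ} (hj : j ≤ i) :
    ∏ l : Fin j, (q ^ i - q ^ (l : ℕ)) =
      q ^ (i * j) * ∏ l ∈ Finset.Icc (i - j + 1) i, (1 - q⁻¹ ^ l) := by
  have h : ∏ l ∈ Finset.Icc (i - j + 1) i, (1 - q⁻¹ ^ l) =
      ∏ l ∈ Finset.range j, (1 - q⁻¹ ^ (i - l)) := by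
    refine (Finset.prod_nbij' (fun l => i - l) (fun l => i - l) ?_ ?_ ?_ ?_ ?_).symm
    all_goals intro l hl; simp only [Finset.mem_Icc, Finset.mem_range] at *
    all_goals omega
  rw [h, Fin.prod_univ_eq_prod_range (fun l => q ^ i - q ^ l) j, pow_mul]
  have hc : (q ^ i) ^ j = ∏ _l ∈ Finset.range j, q ^ i := by simp
  rw [hc, ← Finset.prod_mul_distrib]
  refine Finset.prod_congr rfl fun l hl => ?_
  have hl' : l ≤ i := (Finset.mem_range.1 hl).le.trans hj
  obtain ⟨c, rfl⟩ := Nat.exists_eq_add_of_le hl'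
  rw [Nat.add_sub_cancel_left, mul_sub, mul_one, pow_add, mul_assoc, ← mul_pow, mul_inv_cancel₀ hq,
    one_pow, mul_one]

/-- Converts the count of transversal subspaces to Gaussian form. Factoring powers of `q` out of
both products leaves the exponent identity `j(m - j) + j² = ij + (m - i)j`. -/
theorem gaussBinom_mul_prod {q : F} (hq : q ≠ 0) (hq1 : ∀ l : ℕ, l ≠ 0 → q ^ l ≠ 1) {i j m : ℕ}
    (hj : j ≤ i) (hi : i ≤ m) :
    q ^ (j * (m - j)) * gaussBinom q⁻¹ i j * ∏ l : Fin j, (q ^ j - q ^ (l : ℕ)) =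
      (∏ l : Fin j, (q ^ i - q ^ (l : ℕ))) * (q ^ (m - i)) ^ j := by
  rw [prod_pow_sub_pow_eq hq hj, prod_pow_sub_pow_eq hq le_rfl, gaussBinom, Nat.sub_self, zero_add]
  have h0 : ∏ l ∈ Finset.Icc 1 j, (1 - q⁻¹ ^ l) ≠ 0 := by
    refine Finset.prod_ne_zero_iff.2 fun l hl => ?_
    rw [sub_ne_zero, inv_pow]
    intro h
    exact hq1 l (by have := (Finset.mem_Icc.1 hl).1; omega) (inv_eq_one.1 h.symm)
  suffices q ^ (j * (m - j)) * q ^ (j * j) = q ^ (i * j) * (q ^ (m - i)) ^ j by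
    rw [mul_right_comm _ _ ((q ^ (m - i)) ^ j), ← this]
    generalize ∏ l ∈ Finset.Icc 1 j, (1 - q⁻¹ ^ l) = b at *
    generalize ∏ l ∈ Finset.Icc (i - j + 1) i, (1 - q⁻¹ ^ l) = a
    field_simp
  rw [← pow_mul, ← pow_add, ← pow_add]
  congr 1
  obtain ⟨a, rfl⟩ := Nat.exists_eq_add_of_le hj
  obtain ⟨b, rfl⟩ := Nat.exists_eq_add_of_le hi
  have e1 : j + a + b - j = a + b := by omega
  have e2 : j + a + b - (j + a) = b := by omega
  rw [e1, e2]
  ring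

theorem prod_pow_sub_pow_ne_zero {q : F} (hq : q ≠ 0) (hq1 : ∀ l : ℕ, l ≠ 0 → q ^ l ≠ 1) (j : ℕ) :
    ∏ l : Fin j, (q ^ j - q ^ (l : ℕ)) ≠ 0 := by
  refine Finset.prod_ne_zero_iff.2 fun l _ => ?_
  rw [sub_ne_zero]
  intro h
  have hl := l.2
  refine hq1 (j - l) (by omega) (mul_left_cancel₀ (pow_ne_zero (l : ℕ) hq) ?_)
  rw [← pow_add, Nat.add_sub_cancel' hl.le, h, mul_one]

end GaussBinom

theorem card_codisjoint_subspaces_eq_gaussBinom {F : Type*} [Field F] [CharZero F]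
    {k X : Type*} [Field k] [Finite k] [AddCommGroup X] [Module k X] [Finite X]
    (U : Submodule k X) {j : ℕ} (hj : j ≤ Module.finrank k U) :
    (Nat.card {W : Submodule k X // Module.finrank k (X ⧸ W) = j ∧ W ⊔ U = ⊤} : F) =
      (Nat.card k : F) ^ (j * (Module.finrank k X - j)) *
        gaussBinom (Nat.card k : F)⁻¹ (Module.finrank k U) j := by
  have hk : 1 < Nat.card k := Finite.one_lt_card
  have hq : (Nat.card k : F) ≠ 0 := by
    have : Nat.card k ≠ 0 := by omega
    exact_mod_cast this
  have hq1 : ∀ l : ℕ, l ≠ 0 → (Nat.card k : F) ^ l ≠ 1 := by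
    intro l hl
    have := (Nat.one_lt_pow hl hk).ne'
    exact_mod_cast this
  have hcast : ∀ i, j ≤ i → ((∏ l : Fin j, (Nat.card k ^ i - Nat.card k ^ (l : ℕ)) : ℕ) : F) =
      ∏ l : Fin j, ((Nat.card k : F) ^ i - (Nat.card k : F) ^ (l : ℕ)) := by
    intro i hi
    rw [Nat.cast_prod]
    refine Finset.prod_congr rfl fun l _ => ?_
    rw [Nat.cast_sub (Nat.pow_le_pow_right hk.le (l.2.le.trans hi))]
    simp
  have h := congrArg (Nat.cast (R := F)) (card_codisjoint_subspaces U hj)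
  rw [Nat.cast_mul, Nat.cast_mul, hcast j le_rfl, hcast _ hj] at h
  refine mul_right_cancel₀ (prod_pow_sub_pow_ne_zero hq hq1 j) (h.trans ?_)
  rw [gaussBinom_mul_prod hq hq1 hj (Submodule.finrank_le U)]
  simp

/-! ### The recursion of the Igusa function. -/

section IgusaRecursion

variable {F : Type*} [Field F]

theorem gaussMultinomial_insert (Y : F) (h : ℕ) {a : ℕ} {I : Finset ℕ} (hI : ∀ i ∈ I, i < a) :
    gaussMultinomial Y h (insert a I) = gaussBinom Y h a * gaussMultinomial Y a I := by
  rw [gaussMultinomial, Finset.sort_insert _ (fun b hb => (hI b hb).le)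
    (fun ha => (hI a ha).ne rfl)]
  rfl

/-- Sort the subsets by their largest element `j`: the rest is a subset of `{1, ..., j - 1}`, and
summing over it, together with the factor `1 / (1 - X j)`, rebuilds `igusa j`. -/
theorem sum_powerset_gaussMultinomial (Y : F) (X : ℕ → F) (h N : ℕ) :
    ∑ I ∈ (Finset.Icc 1 N).powerset, gaussMultinomial Y h I * ∏ i ∈ I, X i / (1 - X i) =
      1 + ∑ j ∈ Finset.Icc 1 N, gaussBinom Y h j * (X j * igusa j Y X) := by
  induction N with
  | zero => simp [gaussMultinomial, gaussMultinomialList]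
  | succ N ih =>
    have hmem : N + 1 ∉ Finset.Icc 1 N := by simp
    have hIcc : Finset.Icc 1 (N + 1) = insert (N + 1) (Finset.Icc 1 N) := by
      ext; simp; omega
    rw [hIcc, Finset.sum_powerset_insert hmem, Finset.sum_insert hmem, ih, add_assoc]
    congr 1
    rw [add_comm, igusa, Nat.add_sub_cancel]
    congr 1
    rw [Finset.mul_sum, Finset.mul_sum, Finset.mul_sum]
    refine Finset.sum_congr rfl fun I hI => ?_
    have hlt : ∀ i ∈ I, i < N + 1 := by
      intro i hi
      have := Finset.mem_Icc.1 (Finset.mem_powerset.1 hI hi)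
      omega
    rw [gaussMultinomial_insert Y h hlt, Finset.prod_insert fun h => (hlt _ h).ne rfl]
    ring

theorem igusa_recursion (Y : F) (X : ℕ → F) {h : ℕ} (hX : 1 - X h ≠ 0) :
    (1 - X h) * igusa h Y X =
      1 + ∑ j ∈ Finset.Icc 1 (h - 1), gaussBinom Y h j * (X j * igusa j Y X) := by
  rw [← sum_powerset_gaussMultinomial, igusa, ← mul_assoc, mul_one_div_cancel hX, one_mul]

theorem gaussBinom_self {Y : F} {h : ℕ} (hY : ∀ l : ℕ, l ≠ 0 → Y ^ l ≠ 1) :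
    gaussBinom Y h h = 1 := by
  rw [gaussBinom, Nat.sub_self, zero_add]
  refine div_self (Finset.prod_ne_zero_iff.2 fun l hl => sub_ne_zero.2 (hY l ?_).symm)
  have := (Finset.mem_Icc.1 hl).1
  omega

/-- Since `(h choose h) = 1`, the term `X h * igusa h` can be absorbed into the sum. Iterating this
form produces the series of `igusaTerm`. -/
theorem igusa_eq_one_add_sum {Y : F} (hY : ∀ l : ℕ, l ≠ 0 → Y ^ l ≠ 1) (X : ℕ → F) {h : ℕ}
    (h1 : 1 ≤ h) (hX : 1 - X h ≠ 0) :
    igusa h Y X = 1 + ∑ j ∈ Finset.Icc 1 h, gaussBinom Y h j * (X j * igusa j Y X) := by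
  have hIcc : Finset.Icc 1 h = insert h (Finset.Icc 1 (h - 1)) := by
    ext; simp; omega
  rw [hIcc, Finset.sum_insert (by simp; omega), gaussBinom_self hY, one_mul]
  linear_combination igusa_recursion Y X hX

/-- The weighted number of chains of length `e` that start at dimension `i`, the terms of the
expansion of the Igusa function as a series. -/
def igusaTerm (Y : F) (X : ℕ → F) : ℕ → ℕ → F
  | 0, _ => 1
  | e + 1, i => ∑ j ∈ Finset.Icc 1 i, gaussBinom Y i j * (X j * igusaTerm Y X e j)

theorem sum_igusaTerm_succ (Y : F) (X : ℕ → F) (E i : ℕ) :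
    ∑ e ∈ Finset.range (E + 1), igusaTerm Y X e i =
      1 + ∑ j ∈ Finset.Icc 1 i,
        gaussBinom Y i j * (X j * ∑ e ∈ Finset.range E, igusaTerm Y X e j) := by
  rw [Finset.sum_range_succ', add_comm]
  congr 1
  simp only [igusaTerm]
  rw [Finset.sum_comm]
  simp only [Finset.mul_sum]

end IgusaRecursion

/-! ### Convergence of the chain expansion. -/

section IgusaReal

theorem gaussBinom_nonneg {Y : ℝ} (h0 : 0 ≤ Y) (h1 : Y < 1) (a b : ℕ) : 0 ≤ gaussBinom Y a b := by
  refine div_nonneg (Finset.prod_nonneg fun i _ => ?_) (Finset.prod_nonneg fun i _ => ?_)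
  all_goals exact sub_nonneg.2 (pow_le_one₀ h0 h1.le)

theorem igusaTerm_nonneg {Y : ℝ} (h0 : 0 ≤ Y) (h1 : Y < 1) {X : ℕ → ℝ} {m : ℕ}
    (hX0 : ∀ j ∈ Finset.Icc 1 m, 0 ≤ X j) (e : ℕ) :
    ∀ i ≤ m, 0 ≤ igusaTerm Y X e i := by
  induction e with
  | zero => intro i _; exact zero_le_one
  | succ e ih =>
    intro i hi
    refine Finset.sum_nonneg fun j hj => ?_
    have hj' := Finset.mem_Icc.1 hj
    exact mul_nonneg (gaussBinom_nonneg h0 h1 _ _)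
      (mul_nonneg (hX0 j (Finset.mem_Icc.2 ⟨hj'.1, hj'.2.trans hi⟩)) (ih j (hj'.2.trans hi)))

theorem igusa_nonneg {Y : ℝ} (h0 : 0 ≤ Y) (h1 : Y < 1) {X : ℕ → ℝ} {m : ℕ}
    (hX0 : ∀ j ∈ Finset.Icc 1 m, 0 ≤ X j) (hX1 : ∀ j ∈ Finset.Icc 1 m, X j < 1)
    {i : ℕ} (hi : i ∈ Finset.Icc 1 m) : 0 ≤ igusa i Y X := by
  induction i using Nat.strong_induction_on with
  | _ i ih =>
    have hi' := Finset.mem_Icc.1 hi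
    have hpos : 0 < 1 - X i := sub_pos.2 (hX1 i hi)
    have hrec := igusa_recursion Y X hpos.ne'
    refine nonneg_of_mul_nonneg_right (a := 1 - X i) ?_ hpos
    rw [hrec]
    refine add_nonneg zero_le_one (Finset.sum_nonneg fun j hj => ?_)
    have hj' := Finset.mem_Icc.1 hj
    have hjm : j ∈ Finset.Icc 1 m := Finset.mem_Icc.2 ⟨hj'.1, by omega⟩
    exact mul_nonneg (gaussBinom_nonneg h0 h1 _ _)
      (mul_nonneg (hX0 j hjm) (ih j (by omega) hjm))

/-- Partial sums obey the recursion of `igusa` with one term fewer on the right and nonnegative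
coefficients, so the bound propagates by induction on the number of terms. -/
theorem sum_igusaTerm_le {Y : ℝ} (h0 : 0 ≤ Y) (h1 : Y < 1) {X : ℕ → ℝ} {m : ℕ}
    (hX0 : ∀ j ∈ Finset.Icc 1 m, 0 ≤ X j)
    (hX1 : ∀ j ∈ Finset.Icc 1 m, X j < 1) (E : ℕ) :
    ∀ i ∈ Finset.Icc 1 m, ∑ e ∈ Finset.range E, igusaTerm Y X e i ≤ igusa i Y X := by
  have hY : ∀ l : ℕ, l ≠ 0 → Y ^ l ≠ 1 := fun l hl => (pow_lt_one₀ h0 h1 hl).ne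
  induction E with
  | zero => intro i hi; simpa using igusa_nonneg h0 h1 hX0 hX1 hi
  | succ E ih =>
    intro i hi
    have hi' := Finset.mem_Icc.1 hi
    rw [sum_igusaTerm_succ, igusa_eq_one_add_sum hY X hi'.1 (sub_pos.2 (hX1 i hi)).ne']
    gcongr with j hj
    all_goals
      have hjm : j ∈ Finset.Icc 1 m :=
        Finset.mem_Icc.2 ⟨(Finset.mem_Icc.1 hj).1, (Finset.mem_Icc.1 hj).2.trans hi'.2⟩
    · exact gaussBinom_nonneg h0 h1 _ _
    · exact hX0 j hjm
    · exact ih j hjm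

theorem summable_igusaTerm {Y : ℝ} (h0 : 0 ≤ Y) (h1 : Y < 1) {X : ℕ → ℝ} {m : ℕ}
    (hX0 : ∀ j ∈ Finset.Icc 1 m, 0 ≤ X j)
    (hX1 : ∀ j ∈ Finset.Icc 1 m, X j < 1) {i : ℕ} (hi : i ∈ Finset.Icc 1 m) :
    Summable fun e => igusaTerm Y X e i :=
  summable_of_sum_range_le (fun e => igusaTerm_nonneg h0 h1 hX0 e i (Finset.mem_Icc.1 hi).2)
    fun E => sum_igusaTerm_le h0 h1 hX0 hX1 E i hi

end IgusaReal

theorem gaussBinom_ofReal (Y : ℝ) (a b : ℕ) :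
    gaussBinom (Y : ℂ) a b = (gaussBinom Y a b : ℝ) := by
  simp [gaussBinom]

theorem norm_igusaTerm_le {Y : ℝ} (h0 : 0 ≤ Y) (h1 : Y < 1) (X : ℕ → ℂ) (e i : ℕ) :
    ‖igusaTerm (Y : ℂ) X e i‖ ≤ igusaTerm Y (fun j => ‖X j‖) e i := by
  induction e generalizing i with
  | zero => simp [igusaTerm]
  | succ e ih =>
    refine (norm_sum_le _ _).trans (Finset.sum_le_sum fun j _ => ?_)
    rw [norm_mul, norm_mul, gaussBinom_ofReal, Complex.norm_real,
      Real.norm_of_nonneg (gaussBinom_nonneg h0 h1 i j)]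
    gcongr
    · exact gaussBinom_nonneg h0 h1 _ _
    · exact ih j

/-- The series of the terms `igusaTerm` sums to the Igusa function. -/
theorem hasSum_igusaTerm {Y : ℝ} (h0 : 0 ≤ Y) (h1 : Y < 1) {X : ℕ → ℂ} {m : ℕ}
    (hX : ∀ j ∈ Finset.Icc 1 m, ‖X j‖ < 1) {i : ℕ} (hi : i ∈ Finset.Icc 1 m) :
    HasSum (fun e => igusaTerm (Y : ℂ) X e i) (igusa i (Y : ℂ) X) := by
  have hY : ∀ l : ℕ, l ≠ 0 → (Y : ℂ) ^ l ≠ 1 := by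
    intro l hl
    exact_mod_cast (pow_lt_one₀ h0 h1 hl).ne
  have hs : ∀ i ∈ Finset.Icc 1 m, Summable fun e => igusaTerm (Y : ℂ) X e i := fun i hi =>
    (summable_igusaTerm h0 h1 (fun j _ => norm_nonneg (X j)) hX hi).of_norm_bounded
      fun e => norm_igusaTerm_le h0 h1 X e i
  induction i using Nat.strong_induction_on with
  | _ i ih =>
    have hi' := Finset.mem_Icc.1 hi
    have hIcc : Finset.Icc 1 i = insert i (Finset.Icc 1 (i - 1)) := by
      ext; simp; omega
    have hni : i ∉ Finset.Icc 1 (i - 1) := by simp; omega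
    have hjm : ∀ j ∈ Finset.Icc 1 i, j ∈ Finset.Icc 1 m := fun j hj =>
      Finset.mem_Icc.2 ⟨(Finset.mem_Icc.1 hj).1, (Finset.mem_Icc.1 hj).2.trans hi'.2⟩
    have hXi : 1 - X i ≠ 0 := by
      rw [sub_ne_zero]
      intro h
      have h' := hX i hi
      rw [← h, norm_one] at h'
      exact h'.false
    -- The full sums satisfy the Igusa recursion; the term `j = i` contains the unknown itself and
    -- is solved for using `1 - X i ≠ 0`.
    have key : ∑' e, igusaTerm (Y : ℂ) X e i = 1 + ∑ j ∈ Finset.Icc 1 i,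
        gaussBinom (Y : ℂ) i j * (X j * ∑' e, igusaTerm (Y : ℂ) X e j) := by
      rw [(hs i hi).tsum_eq_zero_add]
      congr 1
      simp only [igusaTerm]
      rw [Summable.tsum_finsetSum fun j hj => ((hs j (hjm j hj)).mul_left _).mul_left _]
      simp only [tsum_mul_left]
    have hlow : ∑ j ∈ Finset.Icc 1 (i - 1), gaussBinom (Y : ℂ) i j * (X j * ∑' e, igusaTerm (Y : ℂ) X e j) =
        ∑ j ∈ Finset.Icc 1 (i - 1), gaussBinom (Y : ℂ) i j * (X j * igusa j (Y : ℂ) X) := by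
      refine Finset.sum_congr rfl fun j hj => ?_
      have hj' := Finset.mem_Icc.1 hj
      rw [(ih j (by omega) (hjm j (Finset.mem_Icc.2 ⟨hj'.1, by omega⟩))).tsum_eq]
    rw [hIcc, Finset.sum_insert hni, gaussBinom_self hY, hlow] at key
    have hrec := igusa_recursion (Y : ℂ) X hXi
    have : ∑' e, igusaTerm (Y : ℂ) X e i = igusa i (Y : ℂ) X :=
      mul_left_cancel₀ hXi (by linear_combination key - hrec)
    rw [← this]
    exact (hs i hi).hasSum

/-! ### Lattices between `pW` and `W` as subspaces of the reduction. -/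

section Lattice

open Module
open scoped Pointwise

variable {p : ℕ} [Fact p.Prime] {V : Type*} [AddCommGroup V] [Module ℤ_[p] V]

/-- The additive index `[W : M ∩ W]` of submodules. -/
noncomputable def Submodule.addRelIndex (M W : Submodule ℤ_[p] V) : ℕ :=
  M.toAddSubgroup.relIndex W.toAddSubgroup

theorem Submodule.addRelIndex_mul {M N W : Submodule ℤ_[p] V} (h1 : M ≤ N) (h2 : N ≤ W) :
    M.addRelIndex N * N.addRelIndex W = M.addRelIndex W :=
  AddSubgroup.relIndex_mul_relIndex _ _ _ h1 h2

theorem Submodule.addRelIndex_self (M : Submodule ℤ_[p] V) : M.addRelIndex M = 1 :=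
  AddSubgroup.relIndex_self _

theorem exists_reduction_of_free (W : Type*) [AddCommGroup W] [Module ℤ_[p] W]
    [Module.Free ℤ_[p] W] [Module.Finite ℤ_[p] W] :
    ∃ f : W →ₛₗ[PadicInt.toZMod (p := p)] (Fin (finrank ℤ_[p] W) → ZMod p),
      Function.Surjective f ∧ LinearMap.ker f = (p : ℤ_[p]) • (⊤ : Submodule ℤ_[p] W) := by
  let b := finBasis ℤ_[p] W
  have hr : ∀ c i, b.repr (b.equivFun.symm c) i = c i := by
    intro c i
    rw [← b.equivFun_apply, LinearEquiv.apply_symm_apply]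
  refine ⟨{ toFun := fun w i => PadicInt.toZMod (b.repr w i)
            map_add' := fun x y => by ext i; simp
            map_smul' := fun c x => by ext i; simp }, ?_, ?_⟩
  · intro v
    choose c hc using fun i => ZMod.ringHom_surjective (PadicInt.toZMod (p := p)) (v i)
    refine ⟨b.equivFun.symm c, ?_⟩
    ext i
    exact (congrArg PadicInt.toZMod (hr c i)).trans (hc i)
  · ext w
    have hker : ∀ c : ℤ_[p], PadicInt.toZMod c = 0 ↔ (p : ℤ_[p]) ∣ c := by
      intro c
      rw [← RingHom.mem_ker, PadicInt.ker_toZMod, PadicInt.maximalIdeal_eq_span_p,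
        Ideal.mem_span_singleton]
    rw [LinearMap.mem_ker, Submodule.mem_smul_pointwise_iff_exists]
    constructor
    · intro h
      have h' : ∀ i, (p : ℤ_[p]) ∣ b.repr w i := fun i => (hker _).1 (congrFun h i)
      choose c hc using h'
      refine ⟨b.equivFun.symm c, trivial, b.equivFun.injective ?_⟩
      ext i
      rw [b.equivFun_apply, b.equivFun_apply, hc, map_smul, Finsupp.smul_apply, hr, smul_eq_mul]
    · rintro ⟨w, -, rfl⟩
      ext i
      simp

section Reduction

variable {W : Submodule ℤ_[p] V} {X : Type*} [AddCommGroup X] [Module (ZMod p) X]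
  (f : W →ₛₗ[PadicInt.toZMod (p := p)] X)

instance : RingHomSurjective (PadicInt.toZMod (p := p)) := ⟨ZMod.ringHom_surjective _⟩

/-- The submodule of `W` that is the preimage of a subspace of the reduction of `W`. -/
noncomputable def Submodule.liftReduction (D : Submodule (ZMod p) X) : Submodule ℤ_[p] V :=
  (D.comap f).map W.subtype

variable {f}

theorem Submodule.liftReduction_injective (hf : Function.Surjective f) :
    Function.Injective (Submodule.liftReduction f) :=
  (Submodule.map_injective_of_injective W.injective_subtype).comp
    (Submodule.comap_injective_of_surjective hf)

theorem Submodule.liftReduction_le (D : Submodule (ZMod p) X) :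
    Submodule.liftReduction f D ≤ W := Submodule.map_subtype_le _ _

theorem Submodule.liftReduction_top : Submodule.liftReduction f ⊤ = W := by
  simp [Submodule.liftReduction]

theorem Submodule.liftReduction_bot (hk : LinearMap.ker f = (p : ℤ_[p]) • ⊤) :
    Submodule.liftReduction f ⊥ = (p : ℤ_[p]) • W := by
  rw [Submodule.liftReduction, Submodule.comap_bot, hk, Submodule.map_pointwise_smul,
    Submodule.map_subtype_top]

theorem Submodule.liftReduction_mono {D D' : Submodule (ZMod p) X} (h : D ≤ D') :
    Submodule.liftReduction f D ≤ Submodule.liftReduction f D' :=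
  Submodule.map_mono (Submodule.comap_mono h)

theorem Submodule.exists_liftReduction_eq (hk : LinearMap.ker f = (p : ℤ_[p]) • ⊤)
    {M : Submodule ℤ_[p] V} (h1 : (p : ℤ_[p]) • W ≤ M) (h2 : M ≤ W) :
    ∃ D, Submodule.liftReduction f D = M := by
  refine ⟨(M.comap W.subtype).map f, ?_⟩
  rw [Submodule.liftReduction, Submodule.comap_map_eq, sup_eq_left.2, Submodule.map_comap_subtype,
    inf_eq_right.2 h2]
  rw [← Submodule.map_le_iff_le_comap, hk, Submodule.map_pointwise_smul, Submodule.map_subtype_top]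
  exact h1

theorem Submodule.liftReduction_sup (hf : Function.Surjective f) (D D' : Submodule (ZMod p) X) :
    Submodule.liftReduction f (D ⊔ D') =
      Submodule.liftReduction f D ⊔ Submodule.liftReduction f D' := by
  rw [Submodule.liftReduction, Submodule.liftReduction, Submodule.liftReduction,
    ← Submodule.map_sup]
  congr 1
  rw [← sup_eq_left.2 (show LinearMap.ker f ≤ D.comap f ⊔ D'.comap f from
      le_sup_of_le_left (Submodule.comap_mono bot_le)), ← Submodule.comap_map_eq,
    Submodule.map_sup, Submodule.map_comap_eq_of_surjective hf,
    Submodule.map_comap_eq_of_surjective hf]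

theorem Submodule.addRelIndex_liftReduction (hf : Function.Surjective f)
    (D D' : Submodule (ZMod p) X) :
    (Submodule.liftReduction f D).addRelIndex (Submodule.liftReduction f D') =
      D.toAddSubgroup.relIndex D'.toAddSubgroup := by
  have h1 : ∀ D : Submodule (ZMod p) X, (Submodule.liftReduction f D).toAddSubgroup =
      (D.toAddSubgroup.comap (f : W →+ X)).map (W.subtype : W →+ V) := fun D => rfl
  rw [Submodule.addRelIndex, h1, h1,
    AddSubgroup.relIndex_map_map_of_injective _ _ W.injective_subtype, AddSubgroup.relIndex_comap,
    AddSubgroup.map_comap_eq_self_of_surjective hf]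

end Reduction

/-- Reduction modulo `p` turns `U` into a subspace of dimension `i` and index `p ^ j` into
codimension `j`, so this is the count of transversal subspaces. -/
theorem card_intermediate_lattices {F : Type*} [Field F] [CharZero F] {W U : Submodule ℤ_[p] V}
    [Module.Free ℤ_[p] W] [Module.Finite ℤ_[p] W] (hU1 : (p : ℤ_[p]) • W ≤ U) (hU2 : U ≤ W)
    {i j : ℕ} (hi : ((p : ℤ_[p]) • W).addRelIndex U = p ^ i) (hj : j ≤ i) :
    (Set.ncard {M : Submodule ℤ_[p] V | (p : ℤ_[p]) • W ≤ M ∧ M ≤ W ∧ M ⊔ U = W ∧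
        M.addRelIndex W = p ^ j} : F) =
      (p : F) ^ (j * (finrank ℤ_[p] W - j)) * gaussBinom (p : F)⁻¹ i j := by
  obtain ⟨f, hf, hk⟩ := exists_reduction_of_free (p := p) W
  obtain ⟨D, rfl⟩ := Submodule.exists_liftReduction_eq hk hU1 hU2
  have hp : 1 < p := (Fact.out : p.Prime).one_lt
  have hD : finrank (ZMod p) D = i := by
    rw [← Submodule.liftReduction_bot hk, Submodule.addRelIndex_liftReduction hf] at hi
    refine Nat.pow_right_injective hp ?_
    change p ^ _ = p ^ _
    rw [← hi]
    have h := Module.natCard_eq_pow_finrank (K := ZMod p) (V := D)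
    rw [Nat.card_zmod] at h
    rw [← h]
    exact (AddSubgroup.relIndex_bot_left D.toAddSubgroup).symm
  have hset : {M : Submodule ℤ_[p] V | (p : ℤ_[p]) • W ≤ M ∧ M ≤ W ∧
        M ⊔ Submodule.liftReduction f D = W ∧ M.addRelIndex W = p ^ j} =
      Submodule.liftReduction f '' {E | finrank (ZMod p) (_ ⧸ E) = j ∧ E ⊔ D = ⊤} := by
    have hidx : ∀ E, (Submodule.liftReduction f E).addRelIndex W = p ^ j ↔
        finrank (ZMod p) (_ ⧸ E) = j := by
      intro E
      have h : (Submodule.liftReduction f E).addRelIndex W =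
          p ^ finrank (ZMod p) (_ ⧸ E) := by
        have h0 := Submodule.addRelIndex_liftReduction hf E ⊤
        rw [Submodule.liftReduction_top] at h0
        rw [h0]
        have h := Module.natCard_eq_pow_finrank (K := ZMod p) (V := _ ⧸ E)
        rw [Nat.card_zmod] at h
        rw [← h]
        exact AddSubgroup.relIndex_top_right E.toAddSubgroup
      rw [h]
      exact (Nat.pow_right_injective hp).eq_iff
    have hsup : ∀ E, Submodule.liftReduction f E ⊔ Submodule.liftReduction f D = W ↔
        E ⊔ D = ⊤ := by
      intro E
      rw [← Submodule.liftReduction_sup hf]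
      refine Iff.trans ?_ (Submodule.liftReduction_injective hf).eq_iff
      rw [Submodule.liftReduction_top]
    ext M
    constructor
    · rintro ⟨h1, h2, h3, h4⟩
      obtain ⟨E, rfl⟩ := Submodule.exists_liftReduction_eq hk h1 h2
      exact ⟨E, ⟨(hidx E).1 h4, (hsup E).1 h3⟩, rfl⟩
    · rintro ⟨E, ⟨h1, h2⟩, rfl⟩
      refine ⟨?_, Submodule.liftReduction_le E, (hsup E).2 h2, (hidx E).2 h1⟩
      rw [← Submodule.liftReduction_bot hk]
      exact Submodule.liftReduction_mono bot_le
  rw [hset, Set.ncard_image_of_injective _ (Submodule.liftReduction_injective hf)]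
  have h := card_codisjoint_subspaces_eq_gaussBinom (F := F) D (hj.trans hD.ge)
  rw [Nat.card_zmod, hD, finrank_fin_fun] at h
  exact h

theorem finite_intermediate_lattices (W : Submodule ℤ_[p] V)
    [Module.Free ℤ_[p] W] [Module.Finite ℤ_[p] W] :
    {M : Submodule ℤ_[p] V | (p : ℤ_[p]) • W ≤ M ∧ M ≤ W}.Finite := by
  obtain ⟨f, -, hk⟩ := exists_reduction_of_free (p := p) W
  refine (Set.finite_range (Submodule.liftReduction f)).subset ?_
  rintro M ⟨h1, h2⟩
  exact Submodule.exists_liftReduction_eq hk h1 h2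

theorem addRelIndex_smul_self (W : Submodule ℤ_[p] V)
    [Module.Free ℤ_[p] W] [Module.Finite ℤ_[p] W] :
    ((p : ℤ_[p]) • W).addRelIndex W = p ^ finrank ℤ_[p] W := by
  obtain ⟨f, hf, hk⟩ := exists_reduction_of_free (p := p) W
  have h := Submodule.addRelIndex_liftReduction hf ⊥ ⊤
  rw [Submodule.liftReduction_bot hk, Submodule.liftReduction_top] at h
  rw [h]
  have h2 := AddSubgroup.relIndex_top_right
    (⊥ : Submodule (ZMod p) (Fin (finrank ℤ_[p] W) → ZMod p)).toAddSubgroup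
  refine h2.trans ?_
  refine (AddSubgroup.index_bot).trans ?_
  simp

end Lattice

/-! ### Layers of lattices by exponent of the quotient. -/

section Layer

open Module
open scoped Pointwise

variable {p : ℕ} [Fact p.Prime] {V : Type*} [AddCommGroup V] [Module ℤ_[p] V]

theorem padic_smul_le_smul (c : ℤ_[p]) {M N : Submodule ℤ_[p] V} (h : M ≤ N) : c • M ≤ c • N :=
  Submodule.map_mono h

theorem padic_smul_le (c : ℤ_[p]) (M : Submodule ℤ_[p] V) : c • M ≤ M :=
  Submodule.smul_le_self_of_tower c M

theorem padic_smul_toAddSubgroup (c : ℤ_[p]) (M : Submodule ℤ_[p] V) :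
    (c • M).toAddSubgroup = M.toAddSubgroup.map (LinearMap.lsmul ℤ_[p] V c : V →+ V) := rfl

/-- The submodules `M` of `W` that span `W` together with `U` and such that `p ^ e` is the exponent
of `W / M`. -/
def latticeLayer (e : ℕ) (W U : Submodule ℤ_[p] V) : Set (Submodule ℤ_[p] V) :=
  {M | M ⊔ U = W ∧ ∀ k, (p : ℤ_[p]) ^ k • W ≤ M ↔ e ≤ k}

theorem latticeLayer_le {e : ℕ} {W U M : Submodule ℤ_[p] V} (hM : M ∈ latticeLayer e W U) :
    M ≤ W := hM.1 ▸ le_sup_left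

theorem latticeLayer_zero {W U : Submodule ℤ_[p] V} (hU : U ≤ W) :
    latticeLayer 0 W U = {W} := by
  ext M
  constructor
  · intro hM
    refine le_antisymm (latticeLayer_le hM) ?_
    simpa using (hM.2 0).2 le_rfl
  · rintro rfl
    exact ⟨sup_eq_left.2 hU, fun k => ⟨fun _ => Nat.zero_le _, fun _ => padic_smul_le _ _⟩⟩

/-- The intermediate lattice is `W' = M + pW`. Since `p ^ k W' ≤ M` iff `p ^ (k + 1) W ≤ M`, the
exponent drops by one; `pW ≤ U` gives `W' + U = M + U`; and `W' ≠ W` encodes that the exponent was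
positive. -/
theorem latticeLayer_succ {e : ℕ} {W U : Submodule ℤ_[p] V} (h1 : (p : ℤ_[p]) • W ≤ U) :
    latticeLayer (e + 1) W U =
      ⋃ W' ∈ {W' : Submodule ℤ_[p] V | (p : ℤ_[p]) • W ≤ W' ∧ W' ≤ W ∧ W' ⊔ U = W ∧ W' ≠ W},
        latticeLayer e W' ((p : ℤ_[p]) • W) := by
  have key : ∀ (M : Submodule ℤ_[p] V) (k : ℕ),
      (p : ℤ_[p]) ^ k • (M ⊔ (p : ℤ_[p]) • W) ≤ M ↔ (p : ℤ_[p]) ^ (k + 1) • W ≤ M := by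
    intro M k
    rw [Submodule.smul_sup', sup_le_iff, smul_smul, ← pow_succ]
    exact and_iff_right (padic_smul_le _ _)
  ext M
  simp only [Set.mem_iUnion, Set.mem_ofPred_eq, exists_prop]
  constructor
  · intro hM
    have hMW := latticeLayer_le hM
    refine ⟨M ⊔ (p : ℤ_[p]) • W, ⟨le_sup_right, sup_le hMW (padic_smul_le _ _), ?_, ?_⟩, rfl, ?_⟩
    · rw [sup_assoc, sup_eq_right.2 h1, hM.1]
    · intro h
      have h2 := (key M e).2 ((hM.2 (e + 1)).2 le_rfl)
      rw [h, hM.2 e] at h2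
      omega
    · intro k
      rw [key, hM.2]
      omega
  · rintro ⟨W', ⟨-, -, h4, h5⟩, rfl, h7⟩
    refine ⟨by rw [← h4, sup_assoc, sup_eq_right.2 h1], ?_⟩
    intro k
    cases k with
    | zero =>
      rw [pow_zero, one_smul]
      refine iff_of_false (fun h => h5 ?_) (by omega)
      have hMW : M ≤ W := h4 ▸ le_sup_of_le_left le_sup_left
      rw [le_antisymm hMW h]
      exact sup_eq_left.2 (padic_smul_le _ _)
    | succ k =>
      rw [← key, h7]
      omega

theorem latticeLayer_pairwiseDisjoint (e : ℕ) (U : Submodule ℤ_[p] V)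
    (T : Set (Submodule ℤ_[p] V)) : T.PairwiseDisjoint fun W => latticeLayer e W U := by
  intro W _ W' _ hne
  refine Set.disjoint_left.2 fun M h h' => hne ?_
  rw [← h.1, h'.1]

/-- As `W' + U = W`, the index of `W'` in `W` equals that of `W' ∩ U` in `U`, which divides `[U :
pW] = p ^ i`. This bound makes the jumps of the chain weakly decreasing. -/
theorem intermediate_eq_biUnion {W U : Submodule ℤ_[p] V} (h1 : (p : ℤ_[p]) • W ≤ U) {i : ℕ}
    (hi : ((p : ℤ_[p]) • W).addRelIndex U = p ^ i) :
    {W' : Submodule ℤ_[p] V | (p : ℤ_[p]) • W ≤ W' ∧ W' ≤ W ∧ W' ⊔ U = W ∧ W' ≠ W} =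
      ⋃ j ∈ (Finset.Icc 1 i : Set ℕ), {M : Submodule ℤ_[p] V | (p : ℤ_[p]) • W ≤ M ∧ M ≤ W ∧
        M ⊔ U = W ∧ M.addRelIndex W = p ^ j} := by
  ext M
  simp only [Set.mem_iUnion, Set.mem_ofPred_eq, exists_prop, Finset.coe_Icc, Set.mem_Icc]
  constructor
  · rintro ⟨h2, h3, h4, h5⟩
    have h6 : M.addRelIndex W ∣ p ^ i := by
      have : M.addRelIndex W = M.addRelIndex U := by
        conv_lhs => rw [← h4, sup_comm]
        rw [Submodule.addRelIndex, Submodule.sup_toAddSubgroup]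
        exact AddSubgroup.relIndex_sup_right _ _
      rw [this, ← hi]
      exact AddSubgroup.relIndex_dvd_of_le_left _ h2
    obtain ⟨j, hj, hj'⟩ := (Nat.dvd_prime_pow Fact.out).1 h6
    refine ⟨j, ⟨?_, hj⟩, h2, h3, h4, hj'⟩
    rw [Nat.one_le_iff_ne_zero]
    rintro rfl
    rw [pow_zero] at hj'
    exact h5 (le_antisymm h3 (AddSubgroup.relIndex_eq_one.1 hj'))
  · rintro ⟨j, ⟨hj, -⟩, h2, h3, h4, h5⟩
    refine ⟨h2, h3, h4, ?_⟩
    rintro rfl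
    rw [Submodule.addRelIndex_self] at h5
    exact (Nat.one_lt_pow (by omega) (Fact.out : p.Prime).one_lt).ne h5

variable [Module.Free ℤ_[p] V]

theorem padic_smul_injective {c : ℤ_[p]} (hc : c ≠ 0) :
    Function.Injective (LinearMap.lsmul ℤ_[p] V c) :=
  smul_right_injective V hc

theorem padic_prime_ne_zero : (p : ℤ_[p]) ≠ 0 := by
  exact_mod_cast (Fact.out : p.Prime).ne_zero

theorem finrank_padic_smul {c : ℤ_[p]} (hc : c ≠ 0) (W : Submodule ℤ_[p] V) :
    finrank ℤ_[p] (c • W : Submodule ℤ_[p] V) = finrank ℤ_[p] W :=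
  (Submodule.equivMapOfInjective _ (padic_smul_injective hc) W).finrank_eq.symm

theorem addRelIndex_padic_smul {c : ℤ_[p]} (hc : c ≠ 0) (M W : Submodule ℤ_[p] V) :
    (c • M).addRelIndex (c • W) = M.addRelIndex W := by
  rw [Submodule.addRelIndex, padic_smul_toAddSubgroup, padic_smul_toAddSubgroup]
  exact AddSubgroup.relIndex_map_map_of_injective _ _ (padic_smul_injective hc)

variable [Module.Finite ℤ_[p] V]

/-- The weighted count of a layer is a term of the Igusa series. -/
theorem finsum_latticeLayer {F : Type*} [Field F] [CharZero F] (χ : ℕ →* F) (S : F) {X : ℕ → F}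
    {m : ℕ} (hX : ∀ j ∈ Finset.Icc 1 m, X j = (p : F) ^ (j * (m - j)) * χ p ^ j * S) (e : ℕ) :
    ∀ {W U : Submodule ℤ_[p] V} {i : ℕ}, finrank ℤ_[p] W = m → (p : ℤ_[p]) • W ≤ U → U ≤ W →
      ((p : ℤ_[p]) • W).addRelIndex U = p ^ i →
      (latticeLayer e W U).Finite ∧ (∀ M ∈ latticeLayer e W U, M.addRelIndex W ≠ 0) ∧
      ∑ᶠ M ∈ latticeLayer e W U, χ (M.addRelIndex W) * S ^ e = igusaTerm (p : F)⁻¹ X e i := by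
  induction e with
  | zero =>
    intro W U i _ _ hU _
    rw [latticeLayer_zero hU]
    refine ⟨Set.finite_singleton W, ?_, ?_⟩
    · rintro M rfl
      rw [Submodule.addRelIndex_self]
      exact one_ne_zero
    · rw [finsum_mem_singleton, Submodule.addRelIndex_self, map_one, pow_zero, one_mul]
      rfl
  | succ e ih =>
    intro W U i hW h1 h2 hi
    have hp : p.Prime := Fact.out
    have him : i ≤ m := by
      have h := Submodule.addRelIndex_mul h1 h2
      rw [addRelIndex_smul_self, hi, hW] at h
      exact (Nat.pow_dvd_pow_iff_le_right hp.one_lt).1 ⟨_, h.symm⟩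
    -- The induction continues with `(W', pW)` in place of `(W, U)`: since `[pW : pW'] = [W : W'] =
    -- p ^ j`, the parameter `i` becomes `j`.
    have hstep : ∀ j, ∀ W' : Submodule ℤ_[p] V, (p : ℤ_[p]) • W ≤ W' → W' ≤ W →
        W'.addRelIndex W = p ^ j →
        (latticeLayer e W' ((p : ℤ_[p]) • W)).Finite ∧
        (∀ M ∈ latticeLayer e W' ((p : ℤ_[p]) • W), M.addRelIndex W ≠ 0) ∧
        ∑ᶠ M ∈ latticeLayer e W' ((p : ℤ_[p]) • W), χ (M.addRelIndex W) * S ^ (e + 1) =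
          χ p ^ j * S * igusaTerm (p : F)⁻¹ X e j := by
      intro j W' h3 h4 h5
      have hW' : finrank ℤ_[p] W' = m := by
        refine le_antisymm (hW ▸ Submodule.finrank_mono h4) ?_
        rw [← hW, ← finrank_padic_smul padic_prime_ne_zero W]
        exact Submodule.finrank_mono h3
      obtain ⟨hfin, hne, hsum⟩ := ih hW' (padic_smul_le_smul _ h4) h3
        ((addRelIndex_padic_smul padic_prime_ne_zero _ _).trans h5)
      have hmul : ∀ M ∈ latticeLayer e W' ((p : ℤ_[p]) • W),
          M.addRelIndex W = M.addRelIndex W' * p ^ j := fun M hM => by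
        rw [← h5, Submodule.addRelIndex_mul (latticeLayer_le hM) h4]
      refine ⟨hfin, fun M hM => ?_, ?_⟩
      · rw [hmul M hM]
        exact mul_ne_zero (hne M hM) (pow_ne_zero _ hp.ne_zero)
      · rw [← hsum, mul_finsum_mem]
        refine finsum_mem_congr rfl fun M hM => ?_
        rw [hmul M hM, map_mul, map_pow]
        ring
    have hT := intermediate_eq_biUnion h1 hi
    have hTfin : ∀ j, {M : Submodule ℤ_[p] V | (p : ℤ_[p]) • W ≤ M ∧ M ≤ W ∧
        M ⊔ U = W ∧ M.addRelIndex W = p ^ j}.Finite := fun j =>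
      (finite_intermediate_lattices W).subset fun M hM => ⟨hM.1, hM.2.1⟩
    have hTT : {W' : Submodule ℤ_[p] V | (p : ℤ_[p]) • W ≤ W' ∧ W' ≤ W ∧ W' ⊔ U = W ∧
        W' ≠ W}.Finite :=
      (finite_intermediate_lattices W).subset fun M hM => ⟨hM.1, hM.2.1⟩
    have hidx : ∀ W' ∈ {W' : Submodule ℤ_[p] V | (p : ℤ_[p]) • W ≤ W' ∧ W' ≤ W ∧ W' ⊔ U = W ∧
        W' ≠ W}, ∃ j, W'.addRelIndex W = p ^ j := by
      intro W' hW'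
      rw [hT] at hW'
      simp only [Set.mem_iUnion] at hW'
      obtain ⟨j, -, hj⟩ := hW'
      exact ⟨j, hj.2.2.2⟩
    rw [latticeLayer_succ h1]
    refine ⟨hTT.biUnion fun W' hW' => ?_, ?_, ?_⟩
    · obtain ⟨j, hj⟩ := hidx W' hW'
      exact (hstep j W' hW'.1 hW'.2.1 hj).1
    · intro M hM
      simp only [Set.mem_iUnion] at hM
      obtain ⟨W', hW', hM⟩ := hM
      obtain ⟨j, hj⟩ := hidx W' hW'
      exact (hstep j W' hW'.1 hW'.2.1 hj).2.1 M hM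
    · rw [finsum_mem_biUnion (latticeLayer_pairwiseDisjoint e _ _) hTT fun W' hW' => by
        obtain ⟨j, hj⟩ := hidx W' hW'
        exact (hstep j W' hW'.1 hW'.2.1 hj).1]
      rw [hT, finsum_mem_biUnion ?_ (Finset.finite_toSet _) fun j _ => hTfin j,
        finsum_mem_coe_finset, igusaTerm]
      · refine Finset.sum_congr rfl fun j hj => ?_
        have hj' := Finset.mem_Icc.1 hj
        rw [finsum_mem_congr rfl fun W' hW' => (hstep j W' hW'.1 hW'.2.1 hW'.2.2.2).2.2,
          finsum_mem_eq_finite_toFinset_sum _ (hTfin j), Finset.sum_const, nsmul_eq_mul,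
          ← Set.ncard_eq_toFinset_card _ (hTfin j),
          card_intermediate_lattices h1 h2 hi hj'.2, hW,
          hX j (Finset.mem_Icc.2 ⟨hj'.1, hj'.2.trans him⟩)]
        ring
      · intro j _ j' _ hne
        refine Set.disjoint_left.2 fun M h h' => hne ?_
        exact Nat.pow_right_injective hp.two_le (h.2.2.2.symm.trans h'.2.2.2)

end Layer

/-! ### Summation over all finite-index lattices. -/

section FiniteIndex

open Module
open scoped Pointwise

variable {p : ℕ} [Fact p.Prime] {V : Type*} [AddCommGroup V] [Module ℤ_[p] V]

/-- The least `e` with `p ^ e • V ≤ M`, that is, the exponent of `V / M` is `p ^ e`. -/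
noncomputable def Submodule.expo (M : Submodule ℤ_[p] V) : ℕ :=
  sInf {k | (p : ℤ_[p]) ^ k • (⊤ : Submodule ℤ_[p] V) ≤ M}

/-- The index annihilates the quotient, and in `ℤ_[p]` it is a unit times a power of `p`. -/
theorem exists_pow_smul_top_le {M : Submodule ℤ_[p] V} (hM : M.toAddSubgroup.index ≠ 0) :
    ∃ k, (p : ℤ_[p]) ^ k • (⊤ : Submodule ℤ_[p] V) ≤ M := by
  set N := M.toAddSubgroup.index with hN
  have hN0 : (N : ℤ_[p]) ≠ 0 := by exact_mod_cast hM
  refine ⟨(N : ℤ_[p]).valuation, ?_⟩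
  have hu := PadicInt.unitCoeff_spec hN0
  intro v hv
  obtain ⟨w, -, rfl⟩ := (Submodule.mem_smul_pointwise_iff_exists _ _ _).1 hv
  have h1 : (N : ℤ_[p]) • w ∈ M := by
    rw [Nat.cast_smul_eq_nsmul]
    have := AddSubgroup.nsmul_index_mem M.toAddSubgroup w
    exact this
  rw [hu] at h1
  have h2 := M.smul_mem (((PadicInt.unitCoeff hN0)⁻¹ : ℤ_[p]ˣ) : ℤ_[p]) h1
  rwa [smul_smul, ← mul_assoc, Units.inv_mul, one_mul] at h2

theorem pow_smul_top_le_iff {M : Submodule ℤ_[p] V} (hM : M.toAddSubgroup.index ≠ 0) (k : ℕ) :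
    (p : ℤ_[p]) ^ k • (⊤ : Submodule ℤ_[p] V) ≤ M ↔ M.expo ≤ k := by
  constructor
  · exact fun h => Nat.sInf_le h
  · intro h
    have h0 : (p : ℤ_[p]) ^ M.expo • (⊤ : Submodule ℤ_[p] V) ≤ M :=
      Nat.sInf_mem (exists_pow_smul_top_le hM)
    obtain ⟨c, rfl⟩ := Nat.exists_eq_add_of_le h
    rw [pow_add, mul_smul]
    exact (padic_smul_le_smul _ (padic_smul_le _ _)).trans h0

theorem expo_of_mem_latticeLayer {e : ℕ} {U M : Submodule ℤ_[p] V}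
    (hM : M ∈ latticeLayer e ⊤ U) : M.expo = e := by
  refine le_antisymm (Nat.sInf_le ((hM.2 e).2 le_rfl)) ?_
  exact le_csInf ⟨e, (hM.2 e).2 le_rfl⟩ fun k hk => (hM.2 k).1 hk

variable (p V) in
/-- The submodules of finite index. -/
abbrev FiniteIndexSubmodule := {M : Submodule ℤ_[p] V // M.toAddSubgroup.index ≠ 0}

theorem addRelIndex_top (M : Submodule ℤ_[p] V) : M.addRelIndex ⊤ = M.toAddSubgroup.index :=
  AddSubgroup.relIndex_top_right _

/-- An absolutely convergent sum may be evaluated along finite blocks. -/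
theorem hasSum_sigma_of_summable_norm {ι : Type*} {β : ι → Type*} [∀ i, Finite (β i)]
    {f : (Σ i, β i) → ℂ} {g : ι → ℂ} {a : ℂ} (hg : HasSum g a)
    (hn : Summable fun i => ∑' b, ‖f ⟨i, b⟩‖) (hfg : ∀ i, ∑' b, f ⟨i, b⟩ = g i) :
    HasSum f a := by
  have hs : Summable f := by
    refine Summable.of_norm ((summable_sigma_of_nonneg fun _ => norm_nonneg _).2 ⟨fun i => ?_, hn⟩)
    exact Summable.of_finite
  have h := hs.hasSum.sigma fun i => (Summable.of_finite (f := fun b => f ⟨i, b⟩)).hasSum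
  simp_rw [hfg] at h
  rw [hg.unique h]
  exact hs.hasSum

variable [Module.Free ℤ_[p] V] [Module.Finite ℤ_[p] V]

/-- The sum over finite index submodules of a free `ℤ_p`-module, weighted by a character of the
index and a power indexed by the exponent of the quotient, is an Igusa function. -/
theorem hasSum_finiteIndexSubmodule {m : ℕ} (hm : finrank ℤ_[p] V = m) (hm1 : 1 ≤ m)
    (χ : ℕ →* ℂ) (S : ℂ) {X : ℕ → ℂ}
    (hX : ∀ j ∈ Finset.Icc 1 m, X j = (p : ℂ) ^ (j * (m - j)) * χ p ^ j * S)
    (hX1 : ∀ j ∈ Finset.Icc 1 m, ‖X j‖ < 1) :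
    HasSum (fun M : FiniteIndexSubmodule p V => χ M.1.toAddSubgroup.index * S ^ M.1.expo)
      (igusa m (p : ℂ)⁻¹ X) := by
  have hp : p.Prime := Fact.out
  have hp1 : (1 : ℝ) < p := by exact_mod_cast hp.one_lt
  have hY0 : (0 : ℝ) ≤ (p : ℝ)⁻¹ := by positivity
  have hY1 : (p : ℝ)⁻¹ < 1 := inv_lt_one_of_one_lt₀ hp1
  have hmm : m ∈ Finset.Icc 1 m := Finset.mem_Icc.2 ⟨hm1, le_rfl⟩
  have htop : finrank ℤ_[p] (⊤ : Submodule ℤ_[p] V) = m := by rw [finrank_top, hm]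
  have hidx : ((p : ℤ_[p]) • (⊤ : Submodule ℤ_[p] V)).addRelIndex ⊤ = p ^ m := by
    rw [addRelIndex_smul_self, htop]
  let χr : ℕ →* ℝ := (normHom : ℂ →*₀ ℝ).toMonoidHom.comp χ
  have hχr : ∀ k, χr k = ‖χ k‖ := fun _ => rfl
  -- The layer count is used a second time with real weights, to identify the sums of norms over
  -- layers with a summable series.
  have hXr : ∀ j ∈ Finset.Icc 1 m, ‖X j‖ = (p : ℝ) ^ (j * (m - j)) * χr p ^ j * ‖S‖ := by
    intro j hj
    rw [hX j hj, norm_mul, norm_mul, norm_pow, norm_pow, Complex.norm_natCast, hχr]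
  have hC := fun e => finsum_latticeLayer (V := V) χ S hX e htop (padic_smul_le _ _) le_rfl hidx
  have hR := fun e => finsum_latticeLayer (V := V) χr ‖S‖ hXr e htop (padic_smul_le _ _) le_rfl hidx
  have hmain := hasSum_igusaTerm hY0 hY1 hX1 hmm
  rw [Complex.ofReal_inv, Complex.ofReal_natCast] at hmain
  have hfin : ∀ e, Finite (latticeLayer e (⊤ : Submodule ℤ_[p] V) ⊤) := fun e => (hC e).1
  let E : (Σ e, latticeLayer e (⊤ : Submodule ℤ_[p] V) ⊤) ≃ FiniteIndexSubmodule p V :=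
    { toFun := fun M => ⟨M.2.1, by
        rw [← addRelIndex_top]
        exact (hC M.1).2.1 _ M.2.2⟩
      invFun := fun M => ⟨M.1.expo, M.1, by simp, pow_smul_top_le_iff M.2⟩
      left_inv := by
        rintro ⟨e, M, hM⟩
        obtain rfl := expo_of_mem_latticeLayer hM
        rfl
      right_inv := fun M => rfl }
  rw [← E.hasSum_iff]
  have hval : ∀ e (M : latticeLayer e (⊤ : Submodule ℤ_[p] V) ⊤),
      ((fun M : FiniteIndexSubmodule p V => χ M.1.toAddSubgroup.index * S ^ M.1.expo) ∘ E) ⟨e, M⟩ =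
        χ (M.1.addRelIndex ⊤) * S ^ e := by
    intro e M
    rw [addRelIndex_top]
    change χ _ * S ^ M.1.expo = _
    rw [expo_of_mem_latticeLayer M.2]
    rfl
  refine hasSum_sigma_of_summable_norm hmain ?_ fun e => ?_
  · refine (summable_igusaTerm hY0 hY1 (fun j _ => norm_nonneg (X j)) hX1 hmm).congr fun e => ?_
    rw [← (hR e).2.2, tsum_eq_finsum (Set.toFinite _),
      ← finsum_set_coe_eq_finsum_mem (latticeLayer e (⊤ : Submodule ℤ_[p] V) ⊤)]
    refine finsum_congr fun M => ?_
    rw [hval, norm_mul, norm_pow, hχr]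
  · rw [← (hC e).2.2, tsum_eq_finsum (Set.toFinite _),
      ← finsum_set_coe_eq_finsum_mem (latticeLayer e (⊤ : Submodule ℤ_[p] V) ⊤)]
    exact finsum_congr fun M => hval e M

end FiniteIndex

/-! ### From sums over objects to Dirichlet series. -/

section DirichletSeries

/-- A sum of `(index)⁻ˢ` over a set of objects of nonzero index is a Dirichlet series. -/
theorem hasSum_index_LSeries {T : Type*} (idx : T → ℕ) {s a : ℂ}
    (h : HasSum (fun t : {t : T // idx t ≠ 0} => (idx t.1 : ℂ) ^ (-s)) a) :
    (∀ m : ℕ, 1 ≤ m → {t | idx t = m}.Finite) ∧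
      LSeriesSummable (fun m => ({t | idx t = m}.ncard : ℂ)) s ∧
      LSeries (fun m => ({t | idx t = m}.ncard : ℂ)) s = a := by
  let ix : {t : T // idx t ≠ 0} → ℕ := fun t => idx t.1
  have hE := (Equiv.sigmaFiberEquiv ix).hasSum_iff.2 h
  have hval : ∀ (m : ℕ) (b : {x // ix x = m}),
      ((fun t : {t : T // idx t ≠ 0} => (idx t.1 : ℂ) ^ (-s)) ∘ Equiv.sigmaFiberEquiv ix) ⟨m, b⟩ =
        (m : ℂ) ^ (-s) := by
    intro m b
    have := b.2
    simp only [ix] at this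
    simp [Equiv.sigmaFiberEquiv, this]
  let E : ∀ m : ℕ, 1 ≤ m → {x // ix x = m} ≃ {t | idx t = m} := fun m hm =>
    { toFun := fun x => ⟨x.1.1, x.2⟩
      invFun := fun t => ⟨⟨t.1, fun h0 => by have : idx t.1 = m := t.2; omega⟩, t.2⟩
      left_inv := fun x => rfl
      right_inv := fun x => rfl }
  -- Finiteness comes from convergence: a nonzero constant is not summable over an infinite fibre.
  have hfin : ∀ m : ℕ, 1 ≤ m → {t | idx t = m}.Finite := by
    intro m hm
    have h1 : Summable fun _ : {x // ix x = m} => (m : ℂ) ^ (-s) :=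
      (hE.summable.sigma_factor m).congr fun b => hval m b
    have hm0 : (m : ℂ) ^ (-s) ≠ 0 := by
      rw [Ne, Complex.cpow_eq_zero_iff, not_and_or]
      left
      exact_mod_cast (by omega : m ≠ 0)
    have h2 : Finite {x // ix x = m} := by
      by_contra hinf
      have := not_finite_iff_infinite.1 hinf
      exact hm0 ((summable_const_iff _).1 h1)
    exact Finite.of_equiv _ (E m hm)
  have hfiber : ∀ m : ℕ, HasSum (fun b : {x // ix x = m} =>
      ((fun t : {t : T // idx t ≠ 0} => (idx t.1 : ℂ) ^ (-s)) ∘ Equiv.sigmaFiberEquiv ix) ⟨m, b⟩)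
      (LSeries.term (fun m => ({t | idx t = m}.ncard : ℂ)) s m) := by
    intro m
    rcases Nat.eq_zero_or_pos m with rfl | hm
    · rw [LSeries.term_zero]
      have : IsEmpty {x // ix x = 0} := ⟨fun x => x.1.2 x.2⟩
      exact hasSum_empty
    · have : Finite {x // ix x = m} := Finite.of_equiv _ ((E m hm).symm) (h := hfin m hm)
      have := Fintype.ofFinite {x // ix x = m}
      simp only [hval]
      rw [LSeries.term_of_ne_zero (by omega)]
      convert hasSum_fintype _ using 1
      rw [Finset.sum_const, Finset.card_univ, ← Nat.card_eq_fintype_card, Nat.card_congr (E m hm),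
        nsmul_eq_mul, Complex.cpow_neg, div_eq_mul_inv]
      rfl
  have hsum := hE.sigma hfiber
  exact ⟨hfin, hsum.summable, hsum.tsum_eq⟩

end DirichletSeries

/-! ### Divisibility by `p` when `pR` is maximal. -/

section InertRing

open scoped Pointwise

variable {p : ℕ} [Fact p.Prime] {R : Type*} [CommRing R] [Algebra ℤ_[p] R]

/-- Nakayama: `u` generates `R` modulo `p`, hence generates `R`. -/
theorem isUnit_of_notMem_span_prime [Module.Finite ℤ_[p] R]
    (hR : (Ideal.span {(p : R)}).IsMaximal) {u : R} (hu : u ∉ Ideal.span {(p : R)}) :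
    IsUnit u := by
  have h1 : (⊤ : Submodule ℤ_[p] R) ≤ (Ideal.span {u}).restrictScalars ℤ_[p] := by
    refine Submodule.le_of_le_smul_of_le_jacobson_bot (I := IsLocalRing.maximalIdeal ℤ_[p])
      Module.Finite.fg_top (IsLocalRing.maximalIdeal_le_jacobson _) ?_
    intro x _
    obtain ⟨y, i, hi, hy⟩ := hR.exists_inv hu
    obtain ⟨c, rfl⟩ := Ideal.mem_span_singleton.1 hi
    have hx : x = x * y * u + (p : ℤ_[p]) • (c * x) := by
      rw [Nat.cast_smul_eq_nsmul, nsmul_eq_mul]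
      linear_combination -x * hy
    rw [hx]
    refine Submodule.add_mem_sup (Ideal.mul_mem_left _ _ (Ideal.mem_span_singleton_self u))
      (Submodule.smul_mem_smul ?_ trivial)
    rw [PadicInt.maximalIdeal_eq_span_p]
    exact Ideal.mem_span_singleton_self _
  exact Ideal.span_singleton_eq_top.1 ((Ideal.eq_top_iff_one _).2 (h1 trivial))

/-- Divide `a` by `p` as often as possible. If `a = p ^ k u` with `u ∉ pR`, then `u` is a unit and
`aR = p ^ k R`, so `aR ⊆ M` forces `k` to be at least the exponent. This is where inertness enters.
-/
theorem forall_mul_mem_iff [Module.Finite ℤ_[p] R] (hR : (Ideal.span {(p : R)}).IsMaximal)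
    {M : Submodule ℤ_[p] R} (hM : M.toAddSubgroup.index ≠ 0) (a : R) :
    (∀ r, a * r ∈ M) ↔ a ∈ (p : ℤ_[p]) ^ M.expo • (⊤ : Submodule ℤ_[p] R) := by
  constructor
  · intro h
    suffices ∀ k ≤ M.expo, a ∈ (p : ℤ_[p]) ^ k • (⊤ : Submodule ℤ_[p] R) from this _ le_rfl
    intro k
    induction k with
    | zero => intro _; simp
    | succ k ih =>
      intro hk
      obtain ⟨u, -, rfl⟩ := (Submodule.mem_smul_pointwise_iff_exists _ _ _).1 (ih (by omega))
      have hu : u ∈ Ideal.span {(p : R)} := by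
        by_contra hu
        obtain ⟨v, hv⟩ := (isUnit_of_notMem_span_prime hR hu).exists_right_inv
        have h2 : (p : ℤ_[p]) ^ k • (⊤ : Submodule ℤ_[p] R) ≤ M := by
          intro x hx
          obtain ⟨w, -, rfl⟩ := (Submodule.mem_smul_pointwise_iff_exists _ _ _).1 hx
          have h3 := h (v * w)
          rwa [smul_mul_assoc, ← mul_assoc, hv, one_mul] at h3
        rw [pow_smul_top_le_iff hM] at h2
        omega
      obtain ⟨w, rfl⟩ := Ideal.mem_span_singleton.1 hu
      refine (Submodule.mem_smul_pointwise_iff_exists _ _ _).2 ⟨w, trivial, ?_⟩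
      rw [pow_succ, mul_smul, Nat.cast_smul_eq_nsmul, nsmul_eq_mul]
  · intro ha r
    refine (pow_smul_top_le_iff hM _).2 le_rfl ?_
    obtain ⟨u, -, rfl⟩ := (Submodule.mem_smul_pointwise_iff_exists _ _ _).1 ha
    rw [smul_mul_assoc]
    exact Submodule.smul_mem_pointwise_smul _ _ _ trivial

end InertRing

/-! ### Submodules of a product as projection, fibre and gluing map. -/

section GraphSubmodule

/-- Insert `G + Z` between `G` and `V × Z`: the upper index is that of the projection of `G`, the
lower one that of `G ∩ Z` in `Z`. -/
theorem AddSubgroup.index_eq_index_map_fst_mul_index_comap_inr {V Z : Type*} [AddCommGroup V]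
    [AddCommGroup Z] (G : AddSubgroup (V × Z)) :
    G.index = (G.map (AddMonoidHom.fst V Z)).index * (G.comap (AddMonoidHom.inr V Z)).index := by
  have hker : (AddMonoidHom.fst V Z).ker = (AddMonoidHom.inr V Z).range := by
    ext ⟨v, z⟩
    simp [AddSubgroup.mem_prod, AddMonoidHom.mem_range, eq_comm]
  rw [AddSubgroup.index_comap,
    ← AddSubgroup.index_comap_of_surjective (G.map _) (f := AddMonoidHom.fst V Z)
      Prod.fst_surjective, AddSubgroup.comap_map_eq, hker, mul_comm]
  generalize (AddMonoidHom.inr V Z).range = K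
  rw [← AddSubgroup.relIndex_mul_index (le_sup_left : G ≤ G ⊔ K), sup_comm,
    AddSubgroup.relIndex_sup_right]

variable {S V Z : Type*} [CommRing S] [AddCommGroup V] [Module S V] [AddCommGroup Z] [Module S Z]

/-- The submodule of `V × Z` attached to a submodule `N` of `V`, a submodule `M` of `Z` and a
linear map from `N` to `Z / M`. -/
def graphSubmodule {N : Submodule S V} {M : Submodule S Z} (φ : N →ₗ[S] Z ⧸ M) :
    Submodule S (V × Z) where
  carrier := {x | ∃ h : x.1 ∈ N, φ ⟨x.1, h⟩ = M.mkQ x.2}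
  zero_mem' := ⟨N.zero_mem, by
    rw [Prod.snd_zero, map_zero]
    exact map_zero φ⟩
  add_mem' := by
    rintro x y ⟨hx, hx'⟩ ⟨hy, hy'⟩
    refine ⟨N.add_mem hx hy, ?_⟩
    rw [Prod.snd_add, map_add, ← hx', ← hy', ← map_add]
    rfl
  smul_mem' := by
    rintro c x ⟨hx, hx'⟩
    refine ⟨N.smul_mem c hx, ?_⟩
    rw [Prod.smul_snd, map_smul, ← hx', ← map_smul]
    rfl

theorem mem_graphSubmodule {N : Submodule S V} {M : Submodule S Z} {φ : N →ₗ[S] Z ⧸ M}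
    {x : V × Z} : x ∈ graphSubmodule φ ↔ ∃ h : x.1 ∈ N, φ ⟨x.1, h⟩ = M.mkQ x.2 := Iff.rfl

theorem graphSubmodule_comap_inr {N : Submodule S V} {M : Submodule S Z} (φ : N →ₗ[S] Z ⧸ M) :
    (graphSubmodule φ).comap (LinearMap.inr S V Z) = M := by
  ext z
  rw [Submodule.mem_comap, mem_graphSubmodule]
  have h0 : φ ⟨0, N.zero_mem⟩ = 0 := map_zero φ
  simp [h0, eq_comm (a := (0 : Z ⧸ M))]

theorem graphSubmodule_map_fst {N : Submodule S V} {M : Submodule S Z} (φ : N →ₗ[S] Z ⧸ M) :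
    (graphSubmodule φ).map (LinearMap.fst S V Z) = N := by
  ext v
  rw [Submodule.mem_map]
  constructor
  · rintro ⟨x, ⟨h, -⟩, rfl⟩
    exact h
  · intro hv
    obtain ⟨z, hz⟩ := M.mkQ_surjective (φ ⟨v, hv⟩)
    exact ⟨(v, z), ⟨hv, hz.symm⟩, rfl⟩

theorem graphSubmodule_injective {N : Submodule S V} {M : Submodule S Z} :
    Function.Injective (graphSubmodule : (N →ₗ[S] Z ⧸ M) → Submodule S (V × Z)) := by
  intro φ ψ h
  ext ⟨v, hv⟩
  obtain ⟨z, hz⟩ := M.mkQ_surjective (φ ⟨v, hv⟩)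
  have hmem : (v, z) ∈ graphSubmodule φ := ⟨hv, hz.symm⟩
  rw [h] at hmem
  obtain ⟨_, h2⟩ := hmem
  exact hz.symm.trans h2.symm

/-- The second coordinate over a given `v` is determined modulo `M`, which makes any choice of lifts
linear after passing to `Z / M`. -/
theorem exists_graphSubmodule_eq (I : Submodule S (V × Z)) {N : Submodule S V}
    {M : Submodule S Z} (hN : I.map (LinearMap.fst S V Z) = N)
    (hM : I.comap (LinearMap.inr S V Z) = M) : ∃ φ : N →ₗ[S] Z ⧸ M, graphSubmodule φ = I := by
  have hex : ∀ v : N, ∃ z, ((v : V), z) ∈ I := by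
    rintro ⟨v, hv⟩
    rw [← hN] at hv
    obtain ⟨⟨v, z⟩, hx, rfl⟩ := hv
    exact ⟨z, hx⟩
  choose c hc using hex
  have key : ∀ (v : V) (z z' : Z), (v, z) ∈ I → (v, z') ∈ I → M.mkQ z = M.mkQ z' := by
    intro v z z' h h'
    rw [← sub_eq_zero, ← map_sub, Submodule.mkQ_apply, Submodule.Quotient.mk_eq_zero, ← hM]
    have := I.sub_mem h h'
    simpa using this
  refine ⟨{ toFun := fun v => M.mkQ (c v), map_add' := ?_, map_smul' := ?_ }, ?_⟩
  · intro v w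
    rw [← map_add]
    exact key _ _ _ (hc (v + w)) (I.add_mem (hc v) (hc w))
  · intro a v
    rw [RingHom.id_apply, ← map_smul]
    exact key _ _ _ (hc (a • v)) (I.smul_mem a (hc v))
  · ext ⟨v, z⟩
    constructor
    · rintro ⟨h, h'⟩
      have h2 : z - c ⟨v, h⟩ ∈ M := by
        rw [← Submodule.Quotient.mk_eq_zero, ← Submodule.mkQ_apply, map_sub, sub_eq_zero]
        exact h'.symm
      rw [← hM] at h2
      have h3 := I.add_mem (hc ⟨v, h⟩) h2
      simpa using h3
    · intro h
      have hv : v ∈ N := hN ▸ ⟨(v, z), h, rfl⟩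
      exact ⟨hv, key _ _ _ (hc ⟨v, hv⟩) h⟩

theorem graphSubmodule_index {N : Submodule S V} {M : Submodule S Z} (φ : N →ₗ[S] Z ⧸ M) :
    (graphSubmodule φ).toAddSubgroup.index = N.toAddSubgroup.index * M.toAddSubgroup.index := by
  have hN : (graphSubmodule φ).toAddSubgroup.map (AddMonoidHom.fst V Z) = N.toAddSubgroup :=
    congrArg Submodule.toAddSubgroup (graphSubmodule_map_fst φ)
  have hM : (graphSubmodule φ).toAddSubgroup.comap (AddMonoidHom.inr V Z) = M.toAddSubgroup :=
    congrArg Submodule.toAddSubgroup (graphSubmodule_comap_inr φ)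
  rw [← hN, ← hM]
  exact AddSubgroup.index_eq_index_map_fst_mul_index_comap_inr _

end GraphSubmodule

/-! ### Indices of `p ^ k • N` and the number of gluing maps. -/

section FiniteIndexCount

open Module
open scoped Pointwise

variable {p : ℕ} [Fact p.Prime] {V : Type*} [AddCommGroup V] [Module ℤ_[p] V]
  [Module.Free ℤ_[p] V] [Module.Finite ℤ_[p] V]

theorem finrank_eq_of_index_ne_zero {N : Submodule ℤ_[p] V} (hN : N.toAddSubgroup.index ≠ 0) :
    finrank ℤ_[p] N = finrank ℤ_[p] V := by
  refine le_antisymm (Submodule.finrank_le N) ?_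
  obtain ⟨k, hk⟩ := exists_pow_smul_top_le hN
  have h := Submodule.finrank_mono hk
  rwa [finrank_padic_smul (pow_ne_zero _ padic_prime_ne_zero), finrank_top] at h

theorem index_pow_smul_top (k : ℕ) :
    ((p : ℤ_[p]) ^ k • (⊤ : Submodule ℤ_[p] V)).toAddSubgroup.index =
      p ^ (finrank ℤ_[p] V * k) := by
  rw [← addRelIndex_top]
  induction k with
  | zero => rw [pow_zero, one_smul, Submodule.addRelIndex_self, mul_zero, pow_zero]
  | succ k ih =>
    rw [pow_succ', mul_smul, ← Submodule.addRelIndex_mul (padic_smul_le _ _) (padic_smul_le _ _),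
      ih, addRelIndex_smul_self, finrank_padic_smul (pow_ne_zero _ padic_prime_ne_zero),
      finrank_top]
    ring

theorem index_pow_smul (k : ℕ) (N : Submodule ℤ_[p] V) :
    ((p : ℤ_[p]) ^ k • N).toAddSubgroup.index =
      N.toAddSubgroup.index * p ^ (finrank ℤ_[p] V * k) := by
  rw [← index_pow_smul_top, ← addRelIndex_top, ← addRelIndex_top, ← addRelIndex_top,
    ← Submodule.addRelIndex_mul (padic_smul_le_smul _ le_top) le_top,
    addRelIndex_padic_smul (pow_ne_zero _ padic_prime_ne_zero)]

/-- `N` is free of the same rank as `V`, so a map is a free choice of images of a basis. -/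
theorem card_linearMap_of_index_ne_zero {N : Submodule ℤ_[p] V}
    (hN : N.toAddSubgroup.index ≠ 0) {Z : Type*} [AddCommGroup Z] [Module ℤ_[p] Z]
    (M : Submodule ℤ_[p] Z) :
    Nat.card (N →ₗ[ℤ_[p]] Z ⧸ M) = M.toAddSubgroup.index ^ finrank ℤ_[p] V := by
  let b := finBasisOfFinrankEq ℤ_[p] N (finrank_eq_of_index_ne_zero hN)
  rw [← Nat.card_congr (b.constr ℤ_[p] (M' := Z ⧸ M)).toEquiv, Nat.card_fun, Nat.card_fin]
  rfl

theorem finite_linearMap_of_index_ne_zero (N : Submodule ℤ_[p] V)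
    {Z : Type*} [AddCommGroup Z] [Module ℤ_[p] Z]
    {M : Submodule ℤ_[p] Z} (hM : M.toAddSubgroup.index ≠ 0) :
    Finite (N →ₗ[ℤ_[p]] Z ⧸ M) := by
  have : Finite (Z ⧸ M) := by
    have : M.toAddSubgroup.FiniteIndex := ⟨hM⟩
    exact AddSubgroup.finite_quotient_of_finiteIndex (H := M.toAddSubgroup)
  let b := finBasis ℤ_[p] N
  exact Finite.of_equiv _ (b.constr ℤ_[p] (M' := Z ⧸ M)).toEquiv

end FiniteIndexCount

/-! ### The ideal condition in the Heisenberg Lie ring. -/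

section HeisenbergIdeals

open Module
open scoped Pointwise

/-- Coordinates of the Heisenberg Lie algebra. -/
def heisenbergEquiv (S R : Type*) [CommRing S] [CommRing R] [Algebra S R] :
    heisenbergLie S R ≃ₗ[S] (R × R) × R where
  toFun A := ((A.1 0 1, A.1 1 2), A.1 0 2)
  map_add' A B := rfl
  map_smul' c A := rfl
  invFun x := ⟨!![0, x.1.1, x.2; 0, 0, x.1.2; 0, 0, 0], by
    intro i j h
    fin_cases i <;> fin_cases j <;> simp at h ⊢⟩
  left_inv A := by
    have hA := A.2
    ext i j
    fin_cases i <;> fin_cases j <;>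
      first
      | rfl
      | exact (hA _ _ (by decide)).symm
  right_inv x := rfl

theorem heisenbergEquiv_lie {S R : Type*} [CommRing S] [CommRing R] [Algebra S R]
    (A B : heisenbergLie S R) :
    heisenbergEquiv S R ⁅A, B⁆ =
      (0, (heisenbergEquiv S R A).1.1 * (heisenbergEquiv S R B).1.2 -
        (heisenbergEquiv S R B).1.1 * (heisenbergEquiv S R A).1.2) := by
  obtain ⟨A, hA⟩ := A
  obtain ⟨B, hB⟩ := B
  replace hA : ∀ i j, j ≤ i → A i j = 0 := hA
  replace hB : ∀ i j, j ≤ i → B i j = 0 := hB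
  refine Prod.ext (Prod.ext ?_ ?_) ?_
  · change (A * B - B * A) 0 1 = 0
    simp [Matrix.mul_apply, Fin.sum_univ_three, hA 0 0, hA 1 1, hB 0 0, hB 1 1, hA 2 1, hB 2 1]
  · change (A * B - B * A) 1 2 = 0
    simp [Matrix.mul_apply, Fin.sum_univ_three, hA 1 0, hA 1 1, hB 1 0, hB 1 1, hA 2 2, hB 2 2]
  · change (A * B - B * A) 0 2 = A 0 1 * B 1 2 - B 0 1 * A 1 2
    simp [Matrix.mul_apply, Fin.sum_univ_three, hA 0 0, hB 0 0, hA 2 2, hB 2 2]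

variable {p : ℕ} [Fact p.Prime] {R : Type*} [CommRing R] [Algebra ℤ_[p] R]
  [Module.Finite ℤ_[p] R]

/-- A submodule of the Heisenberg Lie algebra is closed under brackets if and only if its
intersection with the centre contains the ideal generated by its projection. -/
theorem lie_mem_iff (hR : (Ideal.span {(p : R)}).IsMaximal)
    {I : Submodule ℤ_[p] ((R × R) × R)}
    (hM : (I.comap (LinearMap.inr ℤ_[p] (R × R) R)).toAddSubgroup.index ≠ 0) :
    (∀ A B : heisenbergLie ℤ_[p] R, heisenbergEquiv _ _ B ∈ I → heisenbergEquiv _ _ ⁅A, B⁆ ∈ I) ↔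
      I.map (LinearMap.fst ℤ_[p] (R × R) R) ≤
        (p : ℤ_[p]) ^ (I.comap (LinearMap.inr ℤ_[p] (R × R) R)).expo •
          (⊤ : Submodule ℤ_[p] (R × R)) := by
  set M := I.comap (LinearMap.inr ℤ_[p] (R × R) R) with hMdef
  have hmem : ∀ c, ((0, 0), c) ∈ I ↔ c ∈ M := fun c => Iff.rfl
  constructor
  · rintro h _ ⟨⟨⟨a, b⟩, c⟩, hx, rfl⟩
    obtain ⟨B, hB⟩ := (heisenbergEquiv ℤ_[p] R).surjective ((a, b), c)
    have hx' : heisenbergEquiv ℤ_[p] R B ∈ I := hB ▸ hx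
    have key : ∀ a' b' : R, a' * b - a * b' ∈ M := by
      intro a' b'
      obtain ⟨A, hA⟩ := (heisenbergEquiv ℤ_[p] R).surjective ((a', b'), 0)
      have := h A B hx'
      rw [heisenbergEquiv_lie, hA, hB] at this
      exact this
    -- Bracketing with `(0, -r)` and `(r, 0)` isolates `a * r` and `r * b`, so both coordinates are
    -- treated separately.
    obtain ⟨a₀, -, ha₀⟩ := (Submodule.mem_smul_pointwise_iff_exists _ _ _).1
      ((forall_mul_mem_iff hR hM a).1 fun r => by simpa using key 0 (-r))
    obtain ⟨b₀, -, hb₀⟩ := (Submodule.mem_smul_pointwise_iff_exists _ _ _).1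
      ((forall_mul_mem_iff hR hM b).1 fun r => by simpa [mul_comm] using key r 0)
    refine (Submodule.mem_smul_pointwise_iff_exists _ _ _).2 ⟨(a₀, b₀), trivial, ?_⟩
    rw [Prod.smul_mk, ha₀, hb₀]
    rfl
  · intro h A B hB
    rw [heisenbergEquiv_lie]
    obtain ⟨⟨a₀, b₀⟩, -, h₀⟩ := (Submodule.mem_smul_pointwise_iff_exists _ _ _).1
      (h ⟨_, hB, rfl⟩)
    have ha := congrArg Prod.fst h₀
    have hb := congrArg Prod.snd h₀
    simp only [Prod.smul_mk, LinearMap.fst_apply] at ha hb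
    refine (hmem _).2 (M.sub_mem ?_ ?_)
    · rw [mul_comm]
      refine (forall_mul_mem_iff hR hM _).2 ?_ _
      rw [← hb]
      exact Submodule.smul_mem_pointwise_smul _ _ _ trivial
    · refine (forall_mul_mem_iff hR hM _).2 ?_ _
      rw [← ha]
      exact Submodule.smul_mem_pointwise_smul _ _ _ trivial

end HeisenbergIdeals

/-! ### Parametrization of the ideals and factorization of the sum. -/

section HeisenbergZeta

open Module
open scoped Pointwise

variable {p : ℕ} [Fact p.Prime] {R : Type*} [CommRing R] [Algebra ℤ_[p] R]
  [Module.Finite ℤ_[p] R]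

/-- The ideal of the Heisenberg Lie algebra attached to its intersection `M` with the centre, its
projection `p ^ e • N` to the abelianization, and the gluing map `φ`. -/
noncomputable def heisenbergIdeal (hR : (Ideal.span {(p : R)}).IsMaximal) (M : FiniteIndexSubmodule p R)
    (N : FiniteIndexSubmodule p (R × R))
    (φ : ((p : ℤ_[p]) ^ M.1.expo • N.1 : Submodule ℤ_[p] (R × R)) →ₗ[ℤ_[p]] R ⧸ M.1) :
    LieIdeal ℤ_[p] (heisenbergLie ℤ_[p] R) where
  toSubmodule := (graphSubmodule φ).comap (heisenbergEquiv ℤ_[p] R).toLinearMap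
  lie_mem {A B} hB := by
    have hM := M.2
    rw [← graphSubmodule_comap_inr φ] at hM
    refine (lie_mem_iff hR hM).2 ?_ A B hB
    rw [graphSubmodule_map_fst, graphSubmodule_comap_inr]
    exact padic_smul_le_smul _ le_top

theorem index_heisenbergIdeal [Module.Free ℤ_[p] R] (hR : (Ideal.span {(p : R)}).IsMaximal)
    (M : FiniteIndexSubmodule p R) (N : FiniteIndexSubmodule p (R × R))
    (φ : ((p : ℤ_[p]) ^ M.1.expo • N.1 : Submodule ℤ_[p] (R × R)) →ₗ[ℤ_[p]] R ⧸ M.1) :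
    (heisenbergIdeal hR M N φ).toSubmodule.toAddSubgroup.index =
      N.1.toAddSubgroup.index * p ^ (finrank ℤ_[p] (R × R) * M.1.expo) *
        M.1.toAddSubgroup.index := by
  rw [← index_pow_smul, ← graphSubmodule_index φ]
  exact AddSubgroup.index_comap_of_surjective (graphSubmodule φ).toAddSubgroup
    (f := ((heisenbergEquiv ℤ_[p] R).toLinearMap : heisenbergLie ℤ_[p] R →+ (R × R) × R))
    (heisenbergEquiv ℤ_[p] R).surjective

/-- The ideal condition says that the projection lies in `p ^ e • ⊤`, with `e` the exponent of `R /
M`. As multiplication by `p ^ e` is injective, the projection is `p ^ e • N` for a unique `N`, and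
`N` no longer depends on `M`. -/
theorem heisenbergIdeal_bijective [Module.Free ℤ_[p] R]
    (hR : (Ideal.span {(p : R)}).IsMaximal) :
    Function.Bijective (fun x : Σ q : FiniteIndexSubmodule p R × FiniteIndexSubmodule p (R × R),
        ((p : ℤ_[p]) ^ q.1.1.expo • q.2.1 : Submodule ℤ_[p] (R × R)) →ₗ[ℤ_[p]] R ⧸ q.1.1 =>
      (⟨heisenbergIdeal hR x.1.1 x.1.2 x.2, by
        rw [index_heisenbergIdeal]
        exact mul_ne_zero (mul_ne_zero x.1.2.2 (pow_ne_zero _ (Fact.out : p.Prime).ne_zero))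
          x.1.1.2⟩ :
        {I : LieIdeal ℤ_[p] (heisenbergLie ℤ_[p] R) // I.toSubmodule.toAddSubgroup.index ≠ 0})) := by
  constructor
  · rintro ⟨⟨⟨M, hM⟩, ⟨N, hN⟩⟩, φ⟩ ⟨⟨⟨M', hM'⟩, ⟨N', hN'⟩⟩, ψ⟩ h
    have h1 : graphSubmodule φ = graphSubmodule ψ :=
      Submodule.comap_injective_of_surjective
        (f := (heisenbergEquiv ℤ_[p] R).toLinearMap) (heisenbergEquiv ℤ_[p] R).surjective
        (congrArg (fun I => I.1.toSubmodule) h)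
    obtain rfl : M = M' :=
      (graphSubmodule_comap_inr φ).symm.trans
        ((congrArg _ h1).trans (graphSubmodule_comap_inr ψ))
    obtain rfl : N = N' := by
      have h2 : (p : ℤ_[p]) ^ M.expo • N = (p : ℤ_[p]) ^ M.expo • N' :=
        (graphSubmodule_map_fst φ).symm.trans
          ((congrArg _ h1).trans (graphSubmodule_map_fst ψ))
      exact Submodule.map_injective_of_injective
        (padic_smul_injective (pow_ne_zero _ padic_prime_ne_zero)) h2
    obtain rfl := graphSubmodule_injective h1
    rfl
  · rintro ⟨J, hJ⟩
    set H := heisenbergEquiv ℤ_[p] R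
    obtain ⟨I, hI⟩ : ∃ I : Submodule ℤ_[p] ((R × R) × R), I.comap H.toLinearMap = J.toSubmodule :=
      ⟨J.toSubmodule.map H.toLinearMap, Submodule.comap_map_eq_of_injective H.injective _⟩
    have hI0 : I.toAddSubgroup.index ≠ 0 := by
      rw [← hI] at hJ
      rwa [← AddSubgroup.index_comap_of_surjective I.toAddSubgroup
        (f := (H.toLinearMap : heisenbergLie ℤ_[p] R →+ (R × R) × R)) H.surjective]
    rw [AddSubgroup.index_eq_index_map_fst_mul_index_comap_inr] at hI0
    obtain ⟨hN0, hM0⟩ := mul_ne_zero_iff.1 hI0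
    set M := I.comap (LinearMap.inr ℤ_[p] (R × R) R) with hM
    set N₀ := I.map (LinearMap.fst ℤ_[p] (R × R) R) with hN₀
    replace hM0 : M.toAddSubgroup.index ≠ 0 := hM0
    replace hN0 : N₀.toAddSubgroup.index ≠ 0 := hN0
    have hle : N₀ ≤ (p : ℤ_[p]) ^ M.expo • (⊤ : Submodule ℤ_[p] (R × R)) := by
      refine (lie_mem_iff hR hM0).1 fun A B hB => ?_
      have hB' : B ∈ J.toSubmodule := hI ▸ hB
      have := J.lie_mem (x := A) hB'
      change ⁅A, B⁆ ∈ J.toSubmodule at this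
      rwa [← hI] at this
    obtain ⟨N, hN⟩ : ∃ N, (p : ℤ_[p]) ^ M.expo • N = N₀ := by
      refine ⟨N₀.comap (LinearMap.lsmul ℤ_[p] (R × R) ((p : ℤ_[p]) ^ M.expo)), ?_⟩
      refine (Submodule.map_comap_eq _ _).trans (inf_eq_right.2 ?_)
      rw [← Submodule.map_top]
      exact hle
    have hN1 : N.toAddSubgroup.index ≠ 0 := by
      rw [← hN, index_pow_smul] at hN0
      exact left_ne_zero_of_mul hN0
    obtain ⟨φ, hφ⟩ := exists_graphSubmodule_eq I hN.symm hM.symm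
    refine ⟨⟨⟨⟨M, hM0⟩, ⟨N, hN1⟩⟩, φ⟩, Subtype.ext (LieSubmodule.toSubmodule_injective ?_)⟩
    change (graphSubmodule φ).comap H.toLinearMap = J.toSubmodule
    rw [hφ, hI]

theorem hasSum_mul_complex {ι κ : Type*} {f : ι → ℂ} {g : κ → ℂ} {a b : ℂ} (hf : HasSum f a)
    (hg : HasSum g b) : HasSum (fun x : ι × κ => f x.1 * g x.2) (a * b) :=
  hf.mul hg (summable_mul_of_summable_norm (f := f) (g := g) hf.summable.norm hg.summable.norm)

/-- Ideals of finite index of the Heisenberg Lie algebra are determined by their intersection with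
the centre, their projection to the abelianization and a gluing map. -/
noncomputable def heisenbergIdealEquiv [Module.Free ℤ_[p] R]
    (hR : (Ideal.span {(p : R)}).IsMaximal) :
    (Σ q : FiniteIndexSubmodule p R × FiniteIndexSubmodule p (R × R),
        ((p : ℤ_[p]) ^ q.1.1.expo • q.2.1 : Submodule ℤ_[p] (R × R)) →ₗ[ℤ_[p]] R ⧸ q.1.1) ≃
      {I : LieIdeal ℤ_[p] (heisenbergLie ℤ_[p] R) // I.toSubmodule.toAddSubgroup.index ≠ 0} :=
  Equiv.ofBijective _ (heisenbergIdeal_bijective hR)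

/-- The weighted sum over the ideals of the Heisenberg Lie algebra of finite index factors. -/
theorem hasSum_heisenberg_ideals [Module.Free ℤ_[p] R] (hR : (Ideal.span {(p : R)}).IsMaximal)
    (χ : ℕ →* ℂ) {a b : ℂ}
    (ha : HasSum (fun N : FiniteIndexSubmodule p (R × R) => χ N.1.toAddSubgroup.index) a)
    (hb : HasSum (fun M : FiniteIndexSubmodule p R =>
      (M.1.toAddSubgroup.index : ℂ) ^ finrank ℤ_[p] (R × R) * χ M.1.toAddSubgroup.index *
        (χ p ^ finrank ℤ_[p] (R × R)) ^ M.1.expo) b) :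
    HasSum (fun I : {I : LieIdeal ℤ_[p] (heisenbergLie ℤ_[p] R) //
      I.toSubmodule.toAddSubgroup.index ≠ 0} => χ I.1.toSubmodule.toAddSubgroup.index) (a * b) := by
  rw [← (heisenbergIdealEquiv hR).hasSum_iff, mul_comm a b]
  have hprod := hasSum_mul_complex hb ha
  have hfin : ∀ q : FiniteIndexSubmodule p R × FiniteIndexSubmodule p (R × R),
      Finite (((p : ℤ_[p]) ^ q.1.1.expo • q.2.1 : Submodule ℤ_[p] (R × R)) →ₗ[ℤ_[p]]
        R ⧸ q.1.1) := fun q => finite_linearMap_of_index_ne_zero _ q.1.2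
  have hcard : ∀ q : FiniteIndexSubmodule p R × FiniteIndexSubmodule p (R × R),
      Nat.card (((p : ℤ_[p]) ^ q.1.1.expo • q.2.1 : Submodule ℤ_[p] (R × R)) →ₗ[ℤ_[p]]
        R ⧸ q.1.1) = q.1.1.toAddSubgroup.index ^ finrank ℤ_[p] (R × R) := fun q => by
    refine card_linearMap_of_index_ne_zero ?_ q.1.1
    rw [index_pow_smul]
    exact mul_ne_zero q.2.2 (pow_ne_zero _ (Fact.out : p.Prime).ne_zero)
  have hval : ∀ (q : FiniteIndexSubmodule p R × FiniteIndexSubmodule p (R × R))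
      (φ : ((p : ℤ_[p]) ^ q.1.1.expo • q.2.1 : Submodule ℤ_[p] (R × R)) →ₗ[ℤ_[p]] R ⧸ q.1.1),
      ((fun I : {I : LieIdeal ℤ_[p] (heisenbergLie ℤ_[p] R) //
        I.toSubmodule.toAddSubgroup.index ≠ 0} => χ I.1.toSubmodule.toAddSubgroup.index) ∘
        heisenbergIdealEquiv hR) ⟨q, φ⟩ =
      χ q.1.1.toAddSubgroup.index * (χ p ^ finrank ℤ_[p] (R × R)) ^ q.1.1.expo *
        χ q.2.1.toAddSubgroup.index := by
    intro q φ
    refine (congrArg χ (index_heisenbergIdeal hR q.1 q.2 φ)).trans ?_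
    rw [map_mul, map_mul, map_pow, pow_mul]
    ring
  -- The weight does not depend on `φ`, so each block contributes its weight times the number of
  -- gluing maps.
  refine hasSum_sigma_of_summable_norm hprod (hprod.summable.norm.congr fun q => ?_) fun q => ?_
  · simp_rw [hval]
    rw [tsum_const, hcard, nsmul_eq_mul, Nat.cast_pow]
    simp only [norm_mul, norm_pow, Complex.norm_natCast]
    ring
  · simp_rw [hval]
    rw [tsum_const, hcard, nsmul_eq_mul, Nat.cast_pow]
    ring

end HeisenbergZeta

/-! ### Ideals of the abelian Lie ring. -/

section AbelianZeta

variable {p : ℕ} [Fact p.Prime] {ι : Type*}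

theorem pi_padic_lie_eq_zero (x y : ι → ℤ_[p]) : ⁅x, y⁆ = 0 := by
  ext i
  change ⁅x i, y i⁆ = 0
  rw [Ring.lie_def]
  exact sub_eq_zero.2 (mul_comm _ _)

/-- Every submodule of an abelian Lie algebra is an ideal. -/
noncomputable def piPadicLieIdealEquiv : LieIdeal ℤ_[p] (ι → ℤ_[p]) ≃ Submodule ℤ_[p] (ι → ℤ_[p]) where
  toFun I := I.toSubmodule
  invFun N :=
    { N with
      lie_mem := by
        intro x y _
        rw [pi_padic_lie_eq_zero]
        exact N.zero_mem }
  left_inv I := rfl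
  right_inv N := rfl

theorem hasSum_abelian_ideals (χ : ℕ →* ℂ) {a : ℂ}
    (ha : HasSum (fun N : FiniteIndexSubmodule p (ι → ℤ_[p]) => χ N.1.toAddSubgroup.index) a) :
    HasSum (fun I : {I : LieIdeal ℤ_[p] (ι → ℤ_[p]) // I.toSubmodule.toAddSubgroup.index ≠ 0} =>
      χ I.1.toSubmodule.toAddSubgroup.index) a :=
  (Equiv.hasSum_iff (f := fun N : FiniteIndexSubmodule p (ι → ℤ_[p]) => χ N.1.toAddSubgroup.index)
    (piPadicLieIdealEquiv.subtypeEquiv fun _ => Iff.rfl)).2 ha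

end AbelianZeta

/-! ### The inert prime after tensoring with `ℤ_p`. -/

section Inert

open Module

/-- Since `ℤ_p = ℤ + pℤ_p`, every tensor is `1 ⊗ y` modulo `p`. So the kernel of the induced map to
the field `Q` is generated by `p`. -/
theorem isMaximal_span_padic_tensor_of_ker {p : ℕ} [Fact p.Prime] {A Q : Type*} [CommRing A]
    [Field Q] {π : A →+* Q} (hπ : Function.Surjective π)
    (hk : Ideal.span {(p : A)} = RingHom.ker π) :
    (Ideal.span {(p : ℤ_[p] ⊗[ℤ] A)}).IsMaximal := by
  have hpQ : (p : Q) = 0 := by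
    have h : (p : A) ∈ RingHom.ker π := hk ▸ Ideal.mem_span_singleton_self _
    rwa [RingHom.mem_ker, map_natCast] at h
  have : CharP Q p := (CharP.charP_iff_prime_eq_zero Fact.out).2 hpQ
  let f : ℤ_[p] →+* Q := (ZMod.castHom dvd_rfl Q).comp PadicInt.toZMod
  let g : ℤ_[p] ⊗[ℤ] A →ₐ[ℤ] Q := Algebra.TensorProduct.lift f.toIntAlgHom
    π.toIntAlgHom fun _ _ => Commute.all _ _
  have hg : ∀ y, g (1 ⊗ₜ y) = π y := by
    intro y
    refine (Algebra.TensorProduct.lift_tmul _ _ _ _ _).trans ?_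
    rw [map_one, one_mul]
    rfl
  have hdec : ∀ x : ℤ_[p] ⊗[ℤ] A, ∃ (y : A) (z : ℤ_[p] ⊗[ℤ] A), 
      x = 1 ⊗ₜ y + (p : ℤ_[p] ⊗[ℤ] A) * z := by
    intro x
    induction x with
    | zero => exact ⟨0, 0, by simp⟩
    | tmul c y =>
      have hc : c - (c.zmodRepr : ℤ_[p]) ∈ Ideal.span {(p : ℤ_[p])} := by
        rw [← PadicInt.maximalIdeal_eq_span_p]
        exact PadicInt.sub_zmodRepr_mem c
      obtain ⟨d, hd⟩ := Ideal.mem_span_singleton.1 hc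
      refine ⟨c.zmodRepr • y, d ⊗ₜ y, ?_⟩
      rw [← nsmul_eq_mul, TensorProduct.tmul_smul, TensorProduct.smul_tmul',
        TensorProduct.smul_tmul', ← TensorProduct.add_tmul, nsmul_eq_mul, mul_one, nsmul_eq_mul,
        ← hd, add_sub_cancel]
    | add x x' h h' =>
      obtain ⟨y, z, rfl⟩ := h
      obtain ⟨y', z', rfl⟩ := h'
      exact ⟨y + y', z + z', by rw [TensorProduct.tmul_add]; ring⟩
  have hker : Ideal.span {(p : ℤ_[p] ⊗[ℤ] A)} = RingHom.ker (g : ℤ_[p] ⊗[ℤ] A →+* Q) := by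
    apply le_antisymm
    · rw [Ideal.span_singleton_le_iff_mem, RingHom.mem_ker, map_natCast, hpQ]
    · intro x hx
      obtain ⟨y, z, rfl⟩ := hdec x
      have hy : π y = 0 := by
        rw [← hg]
        have : g (1 ⊗ₜ y + (p : ℤ_[p] ⊗[ℤ] A) * z) = 0 := hx
        rwa [map_add, map_mul, map_natCast, hpQ, zero_mul, add_zero] at this
      obtain ⟨w, rfl⟩ := Ideal.mem_span_singleton.1 ((hk.symm ▸ hy : y ∈ Ideal.span {(p : A)}))
      refine Ideal.mem_span_singleton.2 ⟨1 ⊗ₜ w + z, ?_⟩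
      rw [← nsmul_eq_mul, TensorProduct.tmul_smul, nsmul_eq_mul]
      ring
  rw [hker]
  refine RingHom.ker_isMaximal_of_surjective _ fun q => ?_
  obtain ⟨y, rfl⟩ := hπ q
  exact ⟨1 ⊗ₜ y, hg y⟩

variable (K : Type*) [Field K] [NumberField K] (p : ℕ) [Fact p.Prime]

theorem isMaximal_span_padic_tensor (hinert : (Ideal.span {(p : 𝓞 K)}).IsPrime) :
    (Ideal.span {(p : ℤ_[p] ⊗[ℤ] 𝓞 K)}).IsMaximal := by
  have hp0 : (p : 𝓞 K) ≠ 0 := by exact_mod_cast (Fact.out : p.Prime).ne_zero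
  have hmax : (Ideal.span {(p : 𝓞 K)}).IsMaximal :=
    hinert.isMaximal (by rwa [Ne, Ideal.span_singleton_eq_bot])
  let _ : Field (𝓞 K ⧸ Ideal.span {(p : 𝓞 K)}) := Ideal.Quotient.field _
  exact isMaximal_span_padic_tensor_of_ker Ideal.Quotient.mk_surjective Ideal.mk_ker.symm

theorem finrank_padic_tensor : finrank ℤ_[p] (ℤ_[p] ⊗[ℤ] 𝓞 K) = finrank ℚ K := by
  rw [Module.finrank_baseChange, NumberField.RingOfIntegers.rank]

end Inert

/-! ### Specialization of the weights and convergence. -/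

section Main

open Module

/-- The multiplicative function `N ↦ N ^ w` on the natural numbers. -/
noncomputable def natCpowHom (w : ℂ) : ℕ →* ℂ where
  toFun N := (N : ℂ) ^ w
  map_one' := by simp
  map_mul' M N := by rw [Nat.cast_mul, Complex.natCast_mul_natCast_cpow]

/-- The multiplicative function `N ↦ N ^ d * N ^ w` on the natural numbers. -/
noncomputable def natPowCpowHom (d : ℕ) (w : ℂ) : ℕ →* ℂ where
  toFun N := (N : ℂ) ^ d * (N : ℂ) ^ w
  map_one' := by simp
  map_mul' M N := by
    rw [Nat.cast_mul, Complex.natCast_mul_natCast_cpow]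
    ring

theorem norm_prime_pow_mul_lt_one {p : ℕ} (hp : 1 < p) {t : ℂ} {c a b : ℕ} (hb : b ≠ 0)
    (ht : (p : ℝ) ^ c * ‖t‖ < 1) (ha : a ≤ c * b) : ‖(p : ℂ) ^ a * t ^ b‖ < 1 := by
  have hp1 : (1 : ℝ) ≤ p := by exact_mod_cast hp.le
  rw [norm_mul, norm_pow, norm_pow, Complex.norm_natCast]
  calc (p : ℝ) ^ a * ‖t‖ ^ b ≤ (p : ℝ) ^ (c * b) * ‖t‖ ^ b := by gcongr
    _ = ((p : ℝ) ^ c * ‖t‖) ^ b := by rw [pow_mul, mul_pow]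
    _ < 1 := pow_lt_one₀ (by positivity) ht hb

theorem prime_pow_mul_norm_cpow_lt_one {p : ℕ} (hp : 1 < p) {n : ℕ} (hn : 1 ≤ n) {s : ℂ}
    (hs : 2 * (n : ℝ) - 1 < s.re) : (p : ℝ) ^ (2 * n - 1) * ‖(p : ℂ) ^ (-s)‖ < 1 := by
  have hp0 : (0 : ℝ) < p := by exact_mod_cast (by omega : 0 < p)
  rw [Complex.norm_natCast_cpow_of_pos (by omega), ← Real.rpow_natCast, ← Real.rpow_add hp0]
  refine Real.rpow_lt_one_of_one_lt_of_neg (by exact_mod_cast hp) ?_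
  rw [Nat.cast_sub (by omega), Complex.neg_re]
  push_cast
  linarith

/-- The sum over the submodules of finite index of a free module of rank `2n`. -/
theorem hasSum_index_cpow {p : ℕ} [Fact p.Prime] {V : Type*} [AddCommGroup V] [Module ℤ_[p] V]
    [Module.Free ℤ_[p] V] [Module.Finite ℤ_[p] V] {n : ℕ} (hn : 1 ≤ n)
    (hV : finrank ℤ_[p] V = 2 * n) {s : ℂ} (hs : 2 * (n : ℝ) - 1 < s.re) :
    HasSum (fun N : FiniteIndexSubmodule p V => natCpowHom (-s) N.1.toAddSubgroup.index)
      (igusa (2 * n) (p : ℂ)⁻¹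
        fun j => (p : ℂ) ^ (j * (2 * n - j)) * ((p : ℂ) ^ (-s)) ^ j) := by
  have hp : 1 < p := (Fact.out : p.Prime).one_lt
  have h := hasSum_finiteIndexSubmodule (p := p) hV (by omega) (natCpowHom (-s)) 1
    (X := fun j => (p : ℂ) ^ (j * (2 * n - j)) * ((p : ℂ) ^ (-s)) ^ j)
    (fun j _ => (mul_one _).symm) fun j hj => by
      have hj' := Finset.mem_Icc.1 hj
      refine norm_prime_pow_mul_lt_one hp (by omega)
        (prime_pow_mul_norm_cpow_lt_one hp hn hs) ?_
      rw [mul_comm]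
      exact Nat.mul_le_mul_right _ (by omega)
  simpa using h

/-- The sum over the submodules of finite index of a free module of rank `n`, weighted by the
number of gluing maps. -/
theorem hasSum_index_pow_cpow {p : ℕ} [Fact p.Prime] {Z : Type*} [AddCommGroup Z]
    [Module ℤ_[p] Z] [Module.Free ℤ_[p] Z] [Module.Finite ℤ_[p] Z] {n : ℕ} (hn : 1 ≤ n)
    (hZ : finrank ℤ_[p] Z = n) {s : ℂ} (hs : 2 * (n : ℝ) - 1 < s.re) :
    HasSum (fun M : FiniteIndexSubmodule p Z =>
      (M.1.toAddSubgroup.index : ℂ) ^ (2 * n) * natCpowHom (-s) M.1.toAddSubgroup.index *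
        (natCpowHom (-s) p ^ (2 * n)) ^ M.1.expo)
      (igusa n (p : ℂ)⁻¹
        fun j => (p : ℂ) ^ (j * (3 * n - j)) * ((p : ℂ) ^ (-s)) ^ (2 * n + j)) := by
  have hp : 1 < p := (Fact.out : p.Prime).one_lt
  refine hasSum_finiteIndexSubmodule (p := p) hZ hn (natPowCpowHom (2 * n) (-s))
    (natCpowHom (-s) p ^ (2 * n)) ?_ ?_
  -- With weight `N ^ (2n - s)` and `S = t ^ (2n)`, the variable is `p ^ (j(n - j)) * (p ^ (2n) * t)
  -- ^ j * t ^ (2n)`, which is `x_j`.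
  · intro j hj
    have hj' := (Finset.mem_Icc.1 hj).2
    obtain ⟨c, rfl⟩ := Nat.exists_eq_add_of_le hj'
    have e1 : 3 * (j + c) - j = c + 2 * (j + c) := by omega
    change _ = (p : ℂ) ^ (j * (j + c - j)) * ((p : ℂ) ^ (2 * (j + c)) * (p : ℂ) ^ (-s)) ^ j *
      ((p : ℂ) ^ (-s)) ^ (2 * (j + c))
    rw [e1, Nat.add_sub_cancel_left]
    ring
  · intro j hj
    have hj' := Finset.mem_Icc.1 hj
    refine norm_prime_pow_mul_lt_one hp (by omega)
      (prime_pow_mul_norm_cpow_lt_one hp hn hs) ?_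
    obtain ⟨c, rfl⟩ := Nat.exists_eq_add_of_le hj'.2
    calc j * (3 * (j + c) - j) ≤ j * (3 * (j + c)) := Nat.mul_le_mul_left _ (Nat.sub_le _ _)
      _ ≤ (j + c) * (2 * (j + c) + j) := by nlinarith
      _ ≤ (2 * (j + c) - 1) * (2 * (j + c) + j) := Nat.mul_le_mul_right _ (by omega)

end Main

theorem mainTheorem5 (K : Type*) [Field K] [NumberField K] (n : ℕ)
    (hn : n = Module.finrank ℚ K) (p : ℕ) [Fact p.Prime]
    (hinert : (Ideal.span {(p : 𝓞 K)}).IsPrime) :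
    (∀ m : ℕ, 1 ≤ m →
      (idealsOfIndex ℤ_[p] (heisenbergLie ℤ_[p] (ℤ_[p] ⊗[ℤ] 𝓞 K)) m).Finite ∧
      (idealsOfIndex ℤ_[p] (Fin (2 * n) → ℤ_[p]) m).Finite) ∧
    ∀ s : ℂ, 2 * (n : ℝ) - 1 < s.re →
      LSeriesSummable (idealCoeff ℤ_[p] (heisenbergLie ℤ_[p] (ℤ_[p] ⊗[ℤ] 𝓞 K))) s ∧
      LSeriesSummable (idealCoeff ℤ_[p] (Fin (2 * n) → ℤ_[p])) s ∧
      idealZeta ℤ_[p] (heisenbergLie ℤ_[p] (ℤ_[p] ⊗[ℤ] 𝓞 K)) s =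
        idealZeta ℤ_[p] (Fin (2 * n) → ℤ_[p]) s *
          igusa n (p : ℂ)⁻¹
            (fun j => (p : ℂ) ^ (j * (3 * n - j)) * ((p : ℂ) ^ (-s)) ^ (2 * n + j)) := by
  have hn1 : 1 ≤ n := hn ▸ Module.finrank_pos
  have hR := isMaximal_span_padic_tensor K p hinert
  have hZ : Module.finrank ℤ_[p] (ℤ_[p] ⊗[ℤ] 𝓞 K) = n := by rw [finrank_padic_tensor, hn]
  have hV : Module.finrank ℤ_[p] ((ℤ_[p] ⊗[ℤ] 𝓞 K) × (ℤ_[p] ⊗[ℤ] 𝓞 K)) = 2 * n := by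
    rw [Module.finrank_prod, hZ, two_mul]
  have hAb : ∀ s : ℂ, 2 * (n : ℝ) - 1 < s.re → _ := fun s hs =>
    hasSum_index_LSeries
      (fun I : LieIdeal ℤ_[p] (Fin (2 * n) → ℤ_[p]) => I.toSubmodule.toAddSubgroup.index)
      (hasSum_abelian_ideals (natCpowHom (-s))
        (hasSum_index_cpow hn1 (Module.finrank_fin_fun ℤ_[p]) hs))
  have hHeis : ∀ s : ℂ, 2 * (n : ℝ) - 1 < s.re → _ := fun s hs =>
    hasSum_index_LSeries
      (fun I : LieIdeal ℤ_[p] (heisenbergLie ℤ_[p] (ℤ_[p] ⊗[ℤ] 𝓞 K)) =>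
        I.toSubmodule.toAddSubgroup.index)
      (hasSum_heisenberg_ideals hR (natCpowHom (-s)) (hasSum_index_cpow hn1 hV hs)
        (by rw [hV]; exact hasSum_index_pow_cpow hn1 hZ hs))
  refine ⟨fun m hm => ?_, fun s hs => ?_⟩
  -- Finiteness does not involve `s`, so any point of the half-plane serves; here `s = 2n`.
  · have hs : 2 * (n : ℝ) - 1 < ((2 * n : ℕ) : ℂ).re := by
      rw [Complex.natCast_re]
      push_cast
      linarith
    exact ⟨(hHeis _ hs).1 m hm, (hAb _ hs).1 m hm⟩
  · refine ⟨(hHeis s hs).2.1, (hAb s hs).2.1, ?_⟩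
    exact (hHeis s hs).2.2.trans (congrArg (· * _) (hAb s hs).2.2.symm)
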